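/- **Setting.** Let $\Bbbk$ be a field, $\mathcal C$ an abelian $\Bbbk$-linear monoidal category (with $\Bbbk$-bilinear tensor product) and $\mathcal M$ an abelian $\Bbbk$-linear (left) $\mathcal C$-module category whose action $-\triangleright-:\mathcal C\times\mathcal M\to\mathcal M$ is $\Bbbk$-bilinear and right exact in both variables. A functor is right exact if it preserves finite colimits; all functors between $\Bbbk$-linear categories below are $\Bbbk$-linear. A *lax $\mathcal C$-module functor* $F$ carries a natural family $F_{\mathrm a}:c\triangleright F(x)\to F(c\triangleright x)$, compatible with the associativity and unit isomorphisms of the actions; a *$\mathcal C$-module transformation* is a natural transformation commuting with these families. A *lax $\mathcal C$-module monad* is a monad $(T,\mu,\eta)$ on $\mathcal M$ with $T$ a lax $\mathcal C$-module functor and $\mu,\eta$ $\mathcal C$-module transformations. Let $S,T$ be right exact lax $\mathcal C$-module monads on $\mathcal M$. Write $\nabla_X:T(X)\to X$ for the action of an object $X$ of the Eilenberg–Moore category $\mathbf{EM}(T)$, $L_T:\mathcal M\rightleftarrows\mathbf{EM}(T):R_T$ for the free–forgetful adjunction, and $\varepsilon^T$ for its counit. The category $\mathbf{EM}(T)$ is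 a $\mathcal C$-module category through the Linton coequalizers, formed in $\mathbf{EM}(T)$, $$c\blacktriangleright X=\operatorname{coeq}\Big(T(c\triangleright T(X))\rightrightarrows T(c\triangleright X)\Big)$$ of $T(c\triangleright\nabla_X)$ and $\mu_{c\triangleright X}\circ T(T_{\mathrm a})$; its structure morphisms are induced by those of $\mathcal M$. With respect to it, $L_T$ is a $\mathcal C$-module functor through the morphisms $c\blacktriangleright L_T(X)\to L_T(c\triangleright X)$ induced by $T_{\mathrm a}$, and $R_T$ is a lax $\mathcal C$-module functor through the composites $c\triangleright R_T(X)\xrightarrow{\eta}T(c\triangleright R_T(X))\twoheadrightarrow R_T(c\blacktriangleright X)$. The same applies to $S$. Let $\mathbf{LaxRex}(\mathbf{EM}(T),\mathbf{EM}(S))$ be the category of right exact lax $\mathcal C$-module functors $\mathbf{EM}(T)\to\mathbf{EM}(S)$ and $\mathcal C$-module transformations. Let $S\text{-}\mathbf{Biact}_{\mathcal C}\text{-}T$ be the category of $S$-$T$-bimodule objects in right exact lax $\mathcal C$-module endofunctors of $\mathcal M$: an object is a right exact lax $\mathcal C$-module functor $F:\mathcal M\to\mathcal M$ with $\mathcal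 C$-module transformations $F_{\mathrm{la}}:S\circ F\Rightarrow F$ and $F_{\mathrm{ra}}:F\circ T\Rightarrow F$ that are unital, associative, and commute, $F_{\mathrm{la}}\circ (S F_{\mathrm{ra}})=F_{\mathrm{ra}}\circ (F_{\mathrm{la}}T)$; morphisms are the $\mathcal C$-module transformations commuting with both actions. For $F\in S\text{-}\mathbf{Biact}_{\mathcal C}\text{-}T$ let $\bar F:\mathcal M\to\mathbf{EM}(S)$ be $F$ with the $S$-action $F_{\mathrm{la}}$, and let $\bar F\circ_T-:\mathbf{EM}(T)\to\mathbf{EM}(S)$ be the functor sending $X$ to the coequalizer in $\mathbf{EM}(S)$ $$\bar F\circ_T X=\operatorname{coeq}\Big(F T(X)\rightrightarrows F(X)\Big)$$ of $F(\nabla_X)$ and $(F_{\mathrm{ra}})_X$. It is a right exact lax $\mathcal C$-module functor, with the morphisms $c\blacktriangleright(\bar F\circ_T X)\to\bar F\circ_T(c\blacktriangleright X)$ induced by the composites $c\triangleright F(X)\xrightarrow{F_{\mathrm a}}F(c\triangleright X)\to F(c\blacktriangleright X)\twoheadrightarrow\bar F\circ_T(c\blacktriangleright X)$. **Theorem.**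 The functor $$\mathcal C\mathrm{EW}:\mathbf{LaxRex}(\mathbf{EM}(T),\mathbf{EM}(S))\longrightarrow S\text{-}\mathbf{Biact}_{\mathcal C}\text{-}T,\qquad \Phi\longmapsto\big(R_S\circ\Phi\circ L_T,\;R_S\,\varepsilon^S\,\Phi L_T,\;R_S\Phi\,\varepsilon^T L_T\big),\quad t\longmapsto R_S\,t\,L_T,$$ where $R_S\circ\Phi\circ L_T$ carries the composite lax $\mathcal C$-module structure, is an equivalence of categories, and the functor $F\mapsto\bar F\circ_T-$ is a quasi-inverse of it. -/

import Mathlib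

open CategoryTheory CategoryTheory.Limits CategoryTheory.MonoidalCategory
open CategoryTheory.Functor
open scoped CategoryTheory.MonoidalCategory.MonoidalLeftAction

universe w v₁ v₂ v₃ v₄ u₁ u₂ u₃ u₄

namespace LaxModule

/-! ### Module functors and module transformations -/

section ModuleFunctors

variable {C : Type u₁} [Category.{v₁} C] [MonoidalCategory C]
variable {D : Type u₂} [Category.{v₂} D] [MonoidalLeftAction C D]
variable {E : Type u₃} [Category.{v₃} E] [MonoidalLeftAction C E]
variable {E' : Type u₄} [Category.{v₄} E'] [MonoidalLeftAction C E']

open LaxLeftLinear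

/-- The identity functor as a lax module functor. -/
instance laxId : (𝟭 D).LaxLeftLinear C where
  μₗ c d := 𝟙 (c ⊙ₗ d)
  μₗ_naturality_left f d := by simp
  μₗ_naturality_right c _ _ f := by simp
  μₗ_associativity c c' d := by simp
  μₗ_unitality d := by simp

/-- The composite of two lax module functors as a lax module functor. -/
instance laxComp (F : D ⥤ E) (G : E ⥤ E') [F.LaxLeftLinear C] [G.LaxLeftLinear C] :
    (F ⋙ G).LaxLeftLinear C where
  μₗ c d := μₗ G c (F.obj d) ≫ G.map (μₗ F c d)
  μₗ_naturality_left f d := by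
    dsimp
    rw [μₗ_naturality_left_assoc, Category.assoc, ← G.map_comp, ← G.map_comp, μₗ_naturality_left]
  μₗ_naturality_right c _ _ f := by
    dsimp
    rw [μₗ_naturality_right_assoc, Category.assoc, ← G.map_comp, ← G.map_comp, μₗ_naturality_right]
  μₗ_associativity c c' d := by
    dsimp
    rw [Category.assoc, ← G.map_comp, μₗ_associativity, G.map_comp, μₗ_associativity_assoc,
      G.map_comp, MonoidalLeftAction.actionHomRight_comp, Category.assoc,
      μₗ_naturality_right_assoc]
  μₗ_unitality d := by
    dsimp
    rw [Category.assoc, ← G.map_comp, ← μₗ_unitality, ← μₗ_unitality]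

theorem laxId_μₗ (c : C) (d : D) : μₗ (𝟭 D) c d = 𝟙 (c ⊙ₗ d) := rfl

theorem laxComp_μₗ (F : D ⥤ E) (G : E ⥤ E') [F.LaxLeftLinear C] [G.LaxLeftLinear C]
    (c : C) (d : D) : μₗ (F ⋙ G) c d = μₗ G c (F.obj d) ≫ G.map (μₗ F c d) := rfl

variable (C) in
/-- A natural transformation between lax `C`-module functors is a `C`-module transformation if it
commutes with the structure morphisms `c ⊙ₗ F d ⟶ F (c ⊙ₗ d)`. -/
def IsModuleTransformation {F G : D ⥤ E} [F.LaxLeftLinear C] [G.LaxLeftLinear C]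
    (τ : F ⟶ G) : Prop :=
  ∀ (c : C) (d : D), c ⊴ₗ τ.app d ≫ μₗ G c d = μₗ F c d ≫ τ.app (c ⊙ₗ d)

variable (C) in
/-- A lax `C`-module monad: a monad on a `C`-module category whose underlying functor is a lax
`C`-module functor, such that unit and multiplication are `C`-module transformations. -/
class LaxModuleMonad (T : Monad D) extends T.toFunctor.LaxLeftLinear C where
  η_isModule : IsModuleTransformation C T.η
  μ_isModule : IsModuleTransformation C T.μ

variable (C D) in
/-- The action of `C` on `D` is right exact in both variables. -/
class RightExactAction : Prop where
  right (c : C) : PreservesFiniteColimits (MonoidalLeftAction.actionLeft D c)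
  left (d : D) : PreservesFiniteColimits (MonoidalLeftAction.actionRight C d)

/-- The action of `C` on `D` is `k`-bilinear on morphisms. -/
class BilinearAction (k : Type w) [Semiring k] (C : Type u₁) [Category.{v₁} C]
    [MonoidalCategory C] [Preadditive C] [Linear k C] (D : Type u₂) [Category.{v₂} D]
    [Preadditive D] [Linear k D] [MonoidalLeftAction C D] : Prop where
  add_actionHomLeft {c c' : C} (f g : c ⟶ c') (d : D) : (f + g) ⊵ₗ d = f ⊵ₗ d + g ⊵ₗ d
  smul_actionHomLeft (r : k) {c c' : C} (f : c ⟶ c') (d : D) : (r • f) ⊵ₗ d = r • (f ⊵ₗ d)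
  actionHomRight_add (c : C) {d d' : D} (f g : d ⟶ d') : c ⊴ₗ (f + g) = c ⊴ₗ f + c ⊴ₗ g
  actionHomRight_smul (r : k) (c : C) {d d' : D} (f : d ⟶ d') : c ⊴ₗ (r • f) = r • (c ⊴ₗ f)

end ModuleFunctors

/-! ### The module structure on the Eilenberg–Moore category given by Linton coequalizers -/

section Linton

variable {C : Type u₁} [Category.{v₁} C] [MonoidalCategory C]
variable {M : Type u₂} [Category.{v₂} M] [MonoidalLeftAction C M]

open LaxLeftLinear MonoidalLeftAction

theorem monad_η_lin (T : Monad M) [LaxModuleMonad C T] (c : C) (X : M) :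
    c ⊴ₗ T.η.app X ≫ μₗ T.toFunctor c X = T.η.app (c ⊙ₗ X) := by
  have := LaxModuleMonad.η_isModule (C := C) (T := T) c X
  rw [this, laxId_μₗ]
  exact Category.id_comp _

theorem monad_μ_lin (T : Monad M) [LaxModuleMonad C T] (c : C) (X : M) :
    c ⊴ₗ T.μ.app X ≫ μₗ T.toFunctor c X =
      μₗ T.toFunctor c (T.obj X) ≫ T.map (μₗ T.toFunctor c X) ≫ T.μ.app (c ⊙ₗ X) := by
  have := LaxModuleMonad.μ_isModule (C := C) (T := T) c X
  rw [this, laxComp_μₗ, Category.assoc]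

section Coequalizers

variable [HasFiniteColimits M]

instance algebra_hasCoequalizers (T : Monad M) [PreservesFiniteColimits T.toFunctor] :
    HasCoequalizers T.Algebra where
  has_colimit D := Monad.forget_creates_colimits_of_monad_preserves D

instance algebra_hasFiniteColimits (T : Monad M) [PreservesFiniteColimits T.toFunctor] :
    HasFiniteColimits T.Algebra where
  out _ _ _ := ⟨fun D => Monad.forget_creates_colimits_of_monad_preserves D⟩

instance forget_preservesFiniteColimits (T : Monad M) [PreservesFiniteColimits T.toFunctor] :
    PreservesFiniteColimits T.forget where
  preservesFiniteColimits _ _ _ := inferInstance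

end Coequalizers

section Multilinear

variable {T : Monad M}

/-- A morphism of `T`-algebras out of a free algebra, given by its underlying morphism. -/
def freeHom {X : M} {Y : T.Algebra} (f : T.obj X ⟶ Y.A) (h : T.map f ≫ Y.a = T.μ.app X ≫ f) :
    T.free.obj X ⟶ Y where
  f := f
  h := h

/-- The morphism underlying a morphism out of a free algebra. -/
def unfreeHom {X : M} {Y : T.Algebra} (f : T.free.obj X ⟶ Y) : T.obj X ⟶ Y.A := f.f

theorem unfreeHom_h {X : M} {Y : T.Algebra} (f : T.free.obj X ⟶ Y) :
    T.map (unfreeHom f) ≫ Y.a = T.μ.app X ≫ unfreeHom f := f.h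

variable [LaxModuleMonad C T]

/-- The morphism `T (c ⊙ T X) ⟶ T (c ⊙ X)` induced by the action `T X ⟶ X`. -/
def lintonTop (c : C) (X : T.Algebra) : T.free.obj (c ⊙ₗ T.obj X.A) ⟶ T.free.obj (c ⊙ₗ X.A) :=
  T.free.map (c ⊴ₗ X.a)

/-- The morphism `T (c ⊙ T X) ⟶ T (T (c ⊙ X)) ⟶ T (c ⊙ X)` induced by the lax module structure
of `T` and the multiplication. -/
def lintonBot (c : C) (X : T.Algebra) : T.free.obj (c ⊙ₗ T.obj X.A) ⟶ T.free.obj (c ⊙ₗ X.A) :=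
  freeHom (Y := T.free.obj (c ⊙ₗ X.A)) (T.map (μₗ T.toFunctor c X.A) ≫ T.μ.app (c ⊙ₗ X.A)) (by
    have h1 := T.μ.naturality (μₗ T.toFunctor c X.A)
    have h2 := T.assoc (c ⊙ₗ X.A)
    simp only [Functor.comp_map] at h1
    change T.map (T.map (μₗ T.toFunctor c X.A) ≫ T.μ.app (c ⊙ₗ X.A)) ≫ T.μ.app (c ⊙ₗ X.A) = _
    rw [T.map_comp, Category.assoc, h2, reassoc_of% h1]
    rfl)

/-- A morphism `c ⊙ X ⟶ Y` between underlying objects of `T`-algebras which is `T`-linear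
in `X`. -/
def IsMultilinear {c : C} {X Y : T.Algebra} (f : c ⊙ₗ X.A ⟶ Y.A) : Prop :=
  c ⊴ₗ X.a ≫ f = μₗ T.toFunctor c X.A ≫ T.map f ≫ Y.a

theorem isMultilinear_comp {c : C} {X Y Z : T.Algebra} {f : c ⊙ₗ X.A ⟶ Y.A}
    (hf : IsMultilinear f) (g : Y ⟶ Z) : IsMultilinear (f ≫ g.f) := by
  unfold IsMultilinear at *
  rw [reassoc_of% hf, T.map_comp, Category.assoc, g.h]

theorem isMultilinear_whiskerRight {c : C} {X X' Y : T.Algebra} {f : c ⊙ₗ X.A ⟶ Y.A}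
    (hf : IsMultilinear f) (g : X' ⟶ X) : IsMultilinear (c ⊴ₗ g.f ≫ f) := by
  unfold IsMultilinear at *
  rw [← actionHomRight_comp_assoc, ← g.h, actionHomRight_comp_assoc, hf,
    μₗ_naturality_right_assoc, T.map_comp_assoc]

theorem isMultilinear_whiskerLeft {c c' : C} {X Y : T.Algebra} {f : c ⊙ₗ X.A ⟶ Y.A}
    (hf : IsMultilinear f) (g : c' ⟶ c) : IsMultilinear (g ⊵ₗ X.A ≫ f) := by
  unfold IsMultilinear at *
  rw [action_exchange_assoc, hf, T.map_comp_assoc]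
  exact (μₗ_naturality_left_assoc T.toFunctor g X.A _)

theorem unit_isMultilinear (X : T.Algebra) :
    IsMultilinear (C := C) (X := X) (Y := X) (λₗ X.A).hom := by
  unfold IsMultilinear
  rw [← actionUnitIso_hom_naturality]
  rw [← Category.assoc]
  congr 1
  exact μₗ_unitality T.toFunctor X.A

end Multilinear

section Coequalizer

variable {T : Monad M} [LaxModuleMonad C T] [HasFiniteColimits M]
  [PreservesFiniteColimits T.toFunctor]

/-- The Linton coequalizer. -/
noncomputable def linton (c : C) (X : T.Algebra) : T.Algebra :=
  coequalizer (lintonTop c X) (lintonBot c X)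

/-- The projection onto the Linton coequalizer. -/
noncomputable def lintonProj (c : C) (X : T.Algebra) : T.free.obj (c ⊙ₗ X.A) ⟶ linton c X :=
  coequalizer.π (lintonTop c X) (lintonBot c X)

/-- The composite of the unit `c ⊙ X ⟶ T (c ⊙ X)` with the projection onto the Linton coequalizer.
It is the universal morphism out of `c ⊙ X` which is `T`-linear in `X`. -/
noncomputable def lintonUniv (c : C) (X : T.Algebra) : c ⊙ₗ X.A ⟶ (linton c X).A :=
  T.η.app (c ⊙ₗ X.A) ≫ unfreeHom (lintonProj c X)

theorem lintonProj_f (c : C) (X : T.Algebra) :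
    unfreeHom (lintonProj c X) = T.map (lintonUniv c X) ≫ (linton c X).a := by
  rw [lintonUniv, T.map_comp, Category.assoc, unfreeHom_h]
  simp

theorem lintonProj_condition (c : C) (X : T.Algebra) :
    T.map (c ⊴ₗ X.a) ≫ unfreeHom (lintonProj c X) =
      T.map (μₗ T.toFunctor c X.A) ≫ T.μ.app (c ⊙ₗ X.A) ≫ unfreeHom (lintonProj c X) := by
  have := congrArg Monad.Algebra.Hom.f (coequalizer.condition (lintonTop c X) (lintonBot c X))
  exact this.trans (Category.assoc (T.map (μₗ T.toFunctor c X.A)) (T.μ.app (c ⊙ₗ X.A))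
    (unfreeHom (lintonProj c X)))

theorem lintonUniv_isMultilinear (c : C) (X : T.Algebra) : IsMultilinear (lintonUniv c X) := by
  unfold IsMultilinear
  rw [← lintonProj_f]
  have h1 := T.η.naturality (c ⊴ₗ X.a)
  have h2 := T.η.naturality (μₗ T.toFunctor c X.A)
  simp only [Functor.id_map, Functor.id_obj] at h1 h2
  rw [lintonUniv, reassoc_of% h1, lintonProj_condition, ← reassoc_of% h2]
  simp

/-- The universal property of the Linton coequalizer: existence. -/
noncomputable def lintonDesc {c : C} {X Y : T.Algebra} (f : c ⊙ₗ X.A ⟶ Y.A)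
    (hf : IsMultilinear f) : linton c X ⟶ Y :=
  coequalizer.desc (f := lintonTop c X) (g := lintonBot c X)
    (freeHom (T.map f ≫ Y.a) (by
      have h1 := T.μ.naturality f
      simp only [Functor.comp_map] at h1
      rw [T.map_comp, Category.assoc, ← Y.assoc, reassoc_of% h1]))
    (by
      ext
      have h1 := T.μ.naturality f
      simp only [Functor.comp_map] at h1
      change T.map (c ⊴ₗ X.a) ≫ T.map f ≫ Y.a =
        (T.map (μₗ T.toFunctor c X.A) ≫ T.μ.app (c ⊙ₗ X.A)) ≫ T.map f ≫ Y.a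
      unfold IsMultilinear at hf
      rw [Category.assoc, ← reassoc_of% h1, Y.assoc, ← T.map_comp_assoc, hf]
      simp only [Functor.map_comp, Category.assoc])

theorem lintonProj_desc {c : C} {X Y : T.Algebra} (f : c ⊙ₗ X.A ⟶ Y.A) (hf : IsMultilinear f) :
    unfreeHom (lintonProj c X) ≫ (lintonDesc f hf).f = T.map f ≫ Y.a :=
  congrArg Monad.Algebra.Hom.f (coequalizer.π_desc (f := lintonTop c X) (g := lintonBot c X) _ _)

theorem lintonUniv_desc {c : C} {X Y : T.Algebra} (f : c ⊙ₗ X.A ⟶ Y.A) (hf : IsMultilinear f) :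
    lintonUniv c X ≫ (lintonDesc f hf).f = f := by
  have h1 := T.η.naturality f
  simp only [Functor.id_map, Functor.id_obj] at h1
  rw [lintonUniv, Category.assoc, lintonProj_desc, ← reassoc_of% h1, Y.unit, Category.comp_id]

/-- The universal property of the Linton coequalizer: uniqueness. -/
theorem linton_hom_ext {c : C} {X Y : T.Algebra} {f g : linton c X ⟶ Y}
    (h : lintonUniv c X ≫ f.f = lintonUniv c X ≫ g.f) : f = g := by
  apply coequalizer.hom_ext
  ext
  change unfreeHom (lintonProj c X) ≫ f.f = unfreeHom (lintonProj c X) ≫ g.f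
  rw [lintonProj_f, Category.assoc, Category.assoc, ← f.h, ← g.h, ← T.map_comp_assoc, h,
    T.map_comp_assoc]

theorem multilinear_hom_ext {c c' : C} {X Y : T.Algebra} {f g : c ⊙ₗ (linton c' X).A ⟶ Y.A}
    (hf : IsMultilinear f) (hg : IsMultilinear g) [RightExactAction C M]
    (h : c ⊴ₗ lintonUniv c' X ≫ f = c ⊴ₗ lintonUniv c' X ≫ g) : f = g := by
  have := RightExactAction.right (C := C) (D := M) c
  have : Epi (lintonProj c' X) := inferInstanceAs (Epi (coequalizer.π _ _))
  have : Epi (c ⊴ₗ unfreeHom (lintonProj c' X)) :=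
    inferInstanceAs (Epi ((T.forget ⋙ actionLeft M c).map (lintonProj c' X)))
  rw [← cancel_epi (c ⊴ₗ unfreeHom (lintonProj c' X)), lintonProj_f]
  unfold IsMultilinear at hf hg
  rw [actionHomRight_comp_assoc, actionHomRight_comp_assoc, hf, hg, μₗ_naturality_right_assoc,
    μₗ_naturality_right_assoc, ← T.map_comp_assoc, ← T.map_comp_assoc, h]

/-- `c ⊙ -` sends (the underlying diagram of) the Linton coequalizer to a coequalizer. -/
theorem exists_desc_of_action_linton [RightExactAction C M] (c c' : C) (X : T.Algebra) {Y : M}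
    (f : c ⊙ₗ T.obj (c' ⊙ₗ X.A) ⟶ Y)
    (hf : c ⊴ₗ T.map (c' ⊴ₗ X.a) ≫ f =
      c ⊴ₗ T.map (μₗ T.toFunctor c' X.A) ≫ c ⊴ₗ T.μ.app (c' ⊙ₗ X.A) ≫ f) :
    ∃ g : c ⊙ₗ (linton c' X).A ⟶ Y, c ⊴ₗ unfreeHom (lintonProj c' X) ≫ g = f := by
  have := RightExactAction.right (C := C) (D := M) c
  have hl := isColimitOfHasCoequalizerOfPreservesColimit (T.forget ⋙ actionLeft M c)
    (lintonTop c' X) (lintonBot c' X)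
  have hc : (T.forget ⋙ actionLeft M c).map (lintonTop c' X) ≫ f =
      (T.forget ⋙ actionLeft M c).map (lintonBot c' X) ≫ f := by
    change c ⊴ₗ T.map (c' ⊴ₗ X.a) ≫ f =
      c ⊴ₗ (T.map (μₗ T.toFunctor c' X.A) ≫ T.μ.app (c' ⊙ₗ X.A)) ≫ f
    rw [hf, actionHomRight_comp, Category.assoc]
  obtain ⟨g, hg⟩ := Cofork.IsColimit.desc' hl f hc
  exact ⟨g, hg⟩

/-- A morphism `c ⊙ (c' ⊙ X) ⟶ Y` which is `T`-linear in `X` factors through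
`c ⊙ (c' ▶ X)`. -/
theorem exists_multilinear_desc [RightExactAction C M] {c c' : C} {X Y : T.Algebra}
    (f : c ⊙ₗ c' ⊙ₗ X.A ⟶ Y.A)
    (hf : c ⊴ₗ c' ⊴ₗ X.a ≫ f =
      c ⊴ₗ μₗ T.toFunctor c' X.A ≫ μₗ T.toFunctor c (c' ⊙ₗ X.A) ≫ T.map f ≫ Y.a) :
    ∃ g : c ⊙ₗ (linton c' X).A ⟶ Y.A, IsMultilinear g ∧ c ⊴ₗ lintonUniv c' X ≫ g = f := by
  have nμ := T.μ.naturality f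
  simp only [Functor.comp_map] at nμ
  obtain ⟨g, hg⟩ := exists_desc_of_action_linton c c' X
    (μₗ T.toFunctor c (c' ⊙ₗ X.A) ≫ T.map f ≫ Y.a) (by
      rw [reassoc_of% (monad_μ_lin T c (c' ⊙ₗ X.A)), ← reassoc_of% nμ, Y.assoc,
        μₗ_naturality_right_assoc, μₗ_naturality_right_assoc, ← T.map_comp_assoc, hf]
      simp only [Functor.map_comp, Category.assoc])
  refine ⟨g, ?_, ?_⟩
  · have := RightExactAction.right (C := C) (D := M) c
    have : Epi (lintonProj c' X) := inferInstanceAs (Epi (coequalizer.π _ _))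
    have : Epi (c ⊴ₗ T.map (unfreeHom (lintonProj c' X))) :=
      inferInstanceAs (Epi ((T.forget ⋙ T.toFunctor ⋙ actionLeft M c).map (lintonProj c' X)))
    unfold IsMultilinear
    rw [← cancel_epi (c ⊴ₗ T.map (unfreeHom (lintonProj c' X))), ← actionHomRight_comp_assoc,
      unfreeHom_h, actionHomRight_comp_assoc, hg, μₗ_naturality_right_assoc, ← T.map_comp_assoc, hg,
      reassoc_of% (monad_μ_lin T c (c' ⊙ₗ X.A)), ← reassoc_of% nμ, Y.assoc]
    simp only [Functor.map_comp, Category.assoc]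
  · have nη := T.η.naturality f
    simp only [Functor.id_map, Functor.id_obj] at nη
    rw [lintonUniv, actionHomRight_comp_assoc, hg, reassoc_of% (monad_η_lin T c (c' ⊙ₗ X.A)),
      ← reassoc_of% nη, Y.unit, Category.comp_id]

variable [RightExactAction C M]

theorem assoc_isMultilinear (c c' : C) (X : T.Algebra) :
    IsMultilinear (Y := linton c (linton c' X))
      ((αₗ c c' X.A).hom ≫ c ⊴ₗ lintonUniv c' X ≫ lintonUniv c (linton c' X)) := by
  have h1 := lintonUniv_isMultilinear c' X
  have h2 := lintonUniv_isMultilinear c (linton c' X)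
  unfold IsMultilinear at *
  rw [tensor_actionHomRight]
  simp only [Category.assoc, Iso.inv_hom_id_assoc, T.map_comp]
  rw [← actionHomRight_comp_assoc c (c' ⊴ₗ X.a), h1, actionHomRight_comp_assoc,
    actionHomRight_comp_assoc, h2, μₗ_naturality_right_assoc]
  exact (μₗ_associativity_assoc T.toFunctor c c' X.A _).symm

theorem assocInv_isMultilinear (c c' : C) (X : T.Algebra) :
    c ⊴ₗ c' ⊴ₗ X.a ≫ (αₗ c c' X.A).inv ≫ lintonUniv (c ⊗ c') X =
      c ⊴ₗ μₗ T.toFunctor c' X.A ≫ μₗ T.toFunctor c (c' ⊙ₗ X.A) ≫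
        T.map ((αₗ c c' X.A).inv ≫ lintonUniv (c ⊗ c') X) ≫ (linton (c ⊗ c') X).a := by
  have h1 := lintonUniv_isMultilinear (c ⊗ c') X
  unfold IsMultilinear at h1
  rw [← cancel_epi (αₗ c c' (T.obj X.A)).hom]
  have h2 := tensor_actionHomRight_assoc c c' X.a (lintonUniv (c ⊗ c') X)
  rw [← h2, h1, T.map_comp_assoc]
  rw [μₗ_associativity_inv_assoc]
  simp

/-- The associativity isomorphism `(c ⊗ c') ▶ X ≅ c ▶ (c' ▶ X)`, characterised by its
compatibility with the universal morphisms. -/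
noncomputable def lintonAssoc (c c' : C) (X : T.Algebra) :
    linton (c ⊗ c') X ≅ linton c (linton c' X) where
  hom := lintonDesc _ (assoc_isMultilinear c c' X)
  inv := lintonDesc _ (exists_multilinear_desc _ (assocInv_isMultilinear c c' X)).choose_spec.1
  hom_inv_id := by
    apply linton_hom_ext
    rw [Monad.Algebra.comp_f, reassoc_of% (lintonUniv_desc _ (assoc_isMultilinear c c' X)),
      lintonUniv_desc,
      (exists_multilinear_desc _ (assocInv_isMultilinear c c' X)).choose_spec.2]
    simp
  inv_hom_id := by
    apply linton_hom_ext
    refine multilinear_hom_ext (Y := linton c (linton c' X)) ?_ ?_ ?_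
    · exact isMultilinear_comp (lintonUniv_isMultilinear c _) _
    · exact isMultilinear_comp (lintonUniv_isMultilinear c _) _
    · rw [Monad.Algebra.comp_f, ← Category.assoc (lintonUniv c (linton c' X)), lintonUniv_desc,
        ← Category.assoc,
        (exists_multilinear_desc _ (assocInv_isMultilinear c c' X)).choose_spec.2,
        Category.assoc, lintonUniv_desc]
      simp

theorem lintonUniv_assoc (c c' : C) (X : T.Algebra) :
    lintonUniv (c ⊗ c') X ≫ (lintonAssoc c c' X).hom.f =
      (αₗ c c' X.A).hom ≫ c ⊴ₗ lintonUniv c' X ≫ lintonUniv c (linton c' X) :=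
  lintonUniv_desc _ (assoc_isMultilinear c c' X)

variable (C) in
/-- The unit isomorphism `𝟙 ▶ X ≅ X`, characterised by its compatibility with the universal
morphism. -/
noncomputable def lintonUnit (X : T.Algebra) : linton (𝟙_ C) X ≅ X where
  hom := lintonDesc _ (unit_isMultilinear X)
  inv :=
    { f := (λₗ X.A).inv ≫ lintonUniv (𝟙_ C) X
      h := by
        have h1 := lintonUniv_isMultilinear (𝟙_ C) X
        unfold IsMultilinear at h1
        rw [← actionUnitIso_inv_naturality_assoc, h1, T.map_comp_assoc]
        exact (μₗ_unitality_inv_assoc T.toFunctor X.A _).symm }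
  hom_inv_id := by
    apply linton_hom_ext
    rw [Monad.Algebra.comp_f, reassoc_of% (lintonUniv_desc _ (unit_isMultilinear X))]
    simp
  inv_hom_id := by
    ext
    rw [Monad.Algebra.comp_f, Category.assoc, lintonUniv_desc]
    simp

theorem lintonUniv_unit (X : T.Algebra) :
    lintonUniv (𝟙_ C) X ≫ (lintonUnit C X).hom.f = (λₗ X.A).hom :=
  lintonUniv_desc _ (unit_isMultilinear X)

/-- Functoriality of the Linton coequalizer in the first variable. -/
noncomputable def lintonMapLeft {c c' : C} (g : c ⟶ c') (X : T.Algebra) :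
    linton c X ⟶ linton c' X :=
  lintonDesc (g ⊵ₗ X.A ≫ lintonUniv c' X)
    (isMultilinear_whiskerLeft (lintonUniv_isMultilinear c' X) g)

/-- Functoriality of the Linton coequalizer in the second variable. -/
noncomputable def lintonMapRight (c : C) {X X' : T.Algebra} (g : X ⟶ X') :
    linton c X ⟶ linton c X' :=
  lintonDesc (c ⊴ₗ g.f ≫ lintonUniv c X')
    (isMultilinear_whiskerRight (lintonUniv_isMultilinear c X') g)

theorem lintonUniv_mapLeft {c c' : C} (g : c ⟶ c') (X : T.Algebra) :
    lintonUniv c X ≫ (lintonMapLeft g X).f = g ⊵ₗ X.A ≫ lintonUniv c' X :=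
  lintonUniv_desc _ _

theorem lintonUniv_mapRight (c : C) {X X' : T.Algebra} (g : X ⟶ X') :
    lintonUniv c X ≫ (lintonMapRight c g).f = c ⊴ₗ g.f ≫ lintonUniv c X' :=
  lintonUniv_desc _ _

/-- The module category structure on the Eilenberg–Moore category of a right exact lax module
monad. -/
noncomputable instance lintonAction : MonoidalLeftAction C T.Algebra where
  actionObj c X := linton c X
  actionHomLeft g X := lintonMapLeft g X
  actionHomRight c _ _ g := lintonMapRight c g
  actionAssocIso c c' X := lintonAssoc c c' X
  actionUnitIso X := lintonUnit C X
  actionHom_def _ _ := rfl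
  actionHomRight_id c X := by
    apply linton_hom_ext
    rw [lintonUniv_mapRight]
    simp
  id_actionHomLeft c X := by
    apply linton_hom_ext
    rw [lintonUniv_mapLeft]
    simp
  actionHom_comp f₁ f₂ g₁ g₂ := by
    apply linton_hom_ext
    simp only [Monad.Algebra.comp_f, Category.assoc]
    rw [reassoc_of% lintonUniv_mapLeft, lintonUniv_mapRight, reassoc_of% lintonUniv_mapLeft,
      reassoc_of% lintonUniv_mapRight, reassoc_of% lintonUniv_mapLeft, lintonUniv_mapRight]
    simp only [Monad.Algebra.comp_f, comp_actionHomLeft, actionHomRight_comp, Category.assoc]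
    rw [action_exchange_assoc]
  actionAssocIso_hom_naturality f g h := by
    apply linton_hom_ext
    simp only [Monad.Algebra.comp_f, Category.assoc]
    rw [reassoc_of% lintonUniv_mapLeft, reassoc_of% lintonUniv_mapRight, lintonUniv_assoc,
      reassoc_of% lintonUniv_assoc, reassoc_of% lintonUniv_mapLeft, lintonUniv_mapRight,
      action_exchange_assoc, ← actionHomRight_comp_assoc, Monad.Algebra.comp_f,
      reassoc_of% lintonUniv_mapLeft, lintonUniv_mapRight]
    have h1 := actionAssocIso_hom_naturality f g h.f
    simp only [actionHom_def] at h1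
    simp only [Category.assoc] at h1
    rw [reassoc_of% h1]
    simp only [actionHomRight_comp, Category.assoc]
  actionUnitIso_hom_naturality f := by
    apply linton_hom_ext
    simp only [Monad.Algebra.comp_f]
    rw [reassoc_of% lintonUniv_mapRight, lintonUniv_unit, reassoc_of% lintonUniv_unit,
      actionUnitIso_hom_naturality]
  whiskerLeft_actionHomLeft c _ _ f X := by
    rw [← Category.assoc, Iso.eq_comp_inv]
    apply linton_hom_ext
    simp only [Monad.Algebra.comp_f]
    rw [reassoc_of% lintonUniv_mapLeft, lintonUniv_assoc, reassoc_of% lintonUniv_assoc,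
      lintonUniv_mapRight, ← actionHomRight_comp_assoc, lintonUniv_mapLeft]
    simp
  whiskerRight_actionHomLeft c'' f X := by
    rw [← Category.assoc, Iso.eq_comp_inv]
    apply linton_hom_ext
    simp only [Monad.Algebra.comp_f]
    rw [reassoc_of% lintonUniv_mapLeft, lintonUniv_assoc, reassoc_of% lintonUniv_assoc,
      lintonUniv_mapLeft, action_exchange_assoc]
    simp
  associator_actionHom c₁ c₂ c₃ X := by
    apply linton_hom_ext
    simp only [Monad.Algebra.comp_f]
    rw [reassoc_of% lintonUniv_mapLeft, reassoc_of% lintonUniv_assoc, lintonUniv_mapRight,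
      reassoc_of% lintonUniv_assoc, lintonUniv_assoc, ← actionHomRight_comp_assoc,
      lintonUniv_assoc]
    simp
  leftUnitor_actionHom c X := by
    apply linton_hom_ext
    simp only [Monad.Algebra.comp_f]
    rw [lintonUniv_mapLeft, reassoc_of% lintonUniv_assoc, lintonUniv_unit]
    simp
  rightUnitor_actionHom c X := by
    apply linton_hom_ext
    simp only [Monad.Algebra.comp_f]
    rw [lintonUniv_mapLeft, reassoc_of% lintonUniv_assoc, lintonUniv_mapRight,
      ← actionHomRight_comp_assoc, lintonUniv_unit]
    simp

theorem free_isMultilinear (c : C) (X : M) :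
    IsMultilinear (X := T.free.obj X) (Y := T.free.obj (c ⊙ₗ X)) (μₗ T.toFunctor c X) :=
  monad_μ_lin T c X

/-- The morphism `c ▶ T X ⟶ T (c ⊙ X)` induced by the lax module structure of `T`. -/
noncomputable def freeLineator (c : C) (X : M) : linton c (T.free.obj X) ⟶ T.free.obj (c ⊙ₗ X) :=
  lintonDesc (X := T.free.obj X) (Y := T.free.obj (c ⊙ₗ X)) (μₗ T.toFunctor c X)
    (free_isMultilinear c X)

theorem lintonUniv_freeLineator (c : C) (X : M) :
    lintonUniv c (T.free.obj X) ≫ (freeLineator c X).f = μₗ T.toFunctor c X :=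
  lintonUniv_desc (X := T.free.obj X) (Y := T.free.obj (c ⊙ₗ X)) _ (free_isMultilinear c X)

theorem lintonUniv_freeLineator_map (c : C) (X : M) {Y : M} (f : c ⊙ₗ X ⟶ Y) :
    lintonUniv c (T.free.obj X) ≫ (freeLineator c X ≫ T.free.map f).f =
      μₗ T.toFunctor c X ≫ T.map f := by
  rw [← lintonUniv_freeLineator]
  exact (Category.assoc (lintonUniv c (T.free.obj X)) _ _).symm

/-- The free functor is a (lax) module functor. -/
noncomputable instance freeLax : T.free.LaxLeftLinear C where
  μₗ c X := freeLineator c X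
  μₗ_naturality_left {c c'} g X := by
    apply linton_hom_ext
    have h1 : lintonUniv c (T.free.obj X) ≫
        (lintonMapLeft g (T.free.obj X) ≫ freeLineator c' X).f =
        g ⊵ₗ T.obj X ≫ μₗ T.toFunctor c' X := by
      rw [Monad.Algebra.comp_f, reassoc_of% lintonUniv_mapLeft, lintonUniv_freeLineator]
      rfl
    exact h1.trans ((μₗ_naturality_left T.toFunctor g X).trans
      (lintonUniv_freeLineator_map c X _).symm)
  μₗ_naturality_right c X Y g := by
    apply linton_hom_ext
    have h1 : lintonUniv c (T.free.obj X) ≫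
        (lintonMapRight c (T.free.map g) ≫ freeLineator c Y).f =
        c ⊴ₗ T.map g ≫ μₗ T.toFunctor c Y := by
      rw [Monad.Algebra.comp_f, reassoc_of% lintonUniv_mapRight, lintonUniv_freeLineator]
      rfl
    exact h1.trans ((μₗ_naturality_right T.toFunctor c g).trans
      (lintonUniv_freeLineator_map c X _).symm)
  μₗ_associativity c c' X := by
    apply linton_hom_ext
    have h1 : lintonUniv (c ⊗ c') (T.free.obj X) ≫ ((lintonAssoc c c' (T.free.obj X)).hom ≫
        lintonMapRight c (freeLineator c' X) ≫ freeLineator c (c' ⊙ₗ X)).f =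
        (αₗ c c' (T.obj X)).hom ≫ c ⊴ₗ μₗ T.toFunctor c' X ≫ μₗ T.toFunctor c (c' ⊙ₗ X) := by
      rw [Monad.Algebra.comp_f, Monad.Algebra.comp_f, reassoc_of% lintonUniv_assoc,
        reassoc_of% lintonUniv_mapRight, ← actionHomRight_comp_assoc,
        lintonUniv_freeLineator, lintonUniv_freeLineator]
      rfl
    exact (lintonUniv_freeLineator_map (c ⊗ c') X _).trans
      ((μₗ_associativity T.toFunctor c c' X).trans h1.symm)
  μₗ_unitality X := by
    apply linton_hom_ext
    exact (lintonUniv_unit (T.free.obj X)).trans ((μₗ_unitality T.toFunctor X).trans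
      (lintonUniv_freeLineator_map (𝟙_ C) X _).symm)

/-- The forgetful functor is a lax module functor. -/
noncomputable instance forgetLax : T.forget.LaxLeftLinear C where
  μₗ c X := lintonUniv c X
  μₗ_naturality_left g X := (lintonUniv_mapLeft g X).symm
  μₗ_naturality_right c _ _ g := (lintonUniv_mapRight c g).symm
  μₗ_associativity c c' X := lintonUniv_assoc c c' X
  μₗ_unitality X := (lintonUniv_unit X).symm

theorem freeLax_μₗ (c : C) (X : M) : μₗ T.free c X = freeLineator c X := rfl

theorem forgetLax_μₗ (c : C) (X : T.Algebra) : μₗ T.forget c X = lintonUniv c X := rfl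

end Coequalizer

end Linton

/-! ### Linear structure on the Eilenberg–Moore category -/

section Linear

variable (k : Type w) [Semiring k] {M : Type u₂} [Category.{v₂} M] [Preadditive M] [Linear k M]
  (T : Monad M) [T.toFunctor.Additive] [T.toFunctor.Linear k]

instance algebraHomSMul (X Y : T.Algebra) : SMul k (X ⟶ Y) where
  smul r f :=
    { f := r • f.f
      h := by rw [T.toFunctor.map_smul, Linear.smul_comp, f.h, Linear.comp_smul] }

theorem algebra_smul_f {X Y : T.Algebra} (r : k) (f : X ⟶ Y) : (r • f).f = r • f.f := rfl

/-- The category of algebras over a linear monad is linear. -/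
instance algebraLinear : Linear k T.Algebra where
  homModule X Y :=
    { one_smul f := Monad.Algebra.Hom.ext (one_smul k f.f)
      mul_smul r s f := Monad.Algebra.Hom.ext (mul_smul r s f.f)
      smul_zero r := Monad.Algebra.Hom.ext (smul_zero r)
      smul_add r f g := Monad.Algebra.Hom.ext (smul_add r f.f g.f)
      add_smul r s f := Monad.Algebra.Hom.ext (add_smul r s f.f)
      zero_smul f := Monad.Algebra.Hom.ext (zero_smul k f.f) }
  smul_comp _ _ _ r f g := Monad.Algebra.Hom.ext (Linear.smul_comp _ _ _ r f.f g.f)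
  comp_smul _ _ _ f r g := Monad.Algebra.Hom.ext (Linear.comp_smul _ _ _ f.f r g.f)

instance free_additive : T.free.Additive where
  map_add {_ _ f g} := Monad.Algebra.Hom.ext (T.toFunctor.map_add (f := f) (g := g))

instance free_linear : T.free.Linear k where
  map_smul f r := Monad.Algebra.Hom.ext (T.toFunctor.map_smul r f)

instance forget_linear : T.forget.Linear k where
  map_smul _ _ := rfl

end Linear

/-! ### Right exact lax module functors and biact functors -/

section LaxRex

variable (k : Type w) [Semiring k]
variable (C : Type u₁) [Category.{v₁} C] [MonoidalCategory C]
variable (D : Type u₂) [Category.{v₂} D] [Preadditive D] [Linear k D] [MonoidalLeftAction C D]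
variable (E : Type u₃) [Category.{v₃} E] [Preadditive E] [Linear k E] [MonoidalLeftAction C E]

/-- A right exact (`k`-linear) lax `C`-module functor from `D` to `E`. -/
structure LaxRex where
  functor : D ⥤ E
  lax : functor.LaxLeftLinear C
  additive : functor.Additive
  linear : functor.Linear k
  rightExact : PreservesFiniteColimits functor

attribute [instance] LaxRex.lax LaxRex.additive LaxRex.linear LaxRex.rightExact

variable {k C D E}

/-- Morphisms of right exact lax `C`-module functors are `C`-module transformations. -/
@[ext]
structure LaxRex.Hom (F G : LaxRex k C D E) where
  nat : F.functor ⟶ G.functor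
  isModule : IsModuleTransformation C nat

theorem isModuleTransformation_id (F : D ⥤ E) [F.LaxLeftLinear C] :
    IsModuleTransformation C (𝟙 F) := fun c d => by simp

theorem isModuleTransformation_comp {F G H : D ⥤ E} [F.LaxLeftLinear C] [G.LaxLeftLinear C]
    [H.LaxLeftLinear C] {σ : F ⟶ G} {τ : G ⟶ H} (hσ : IsModuleTransformation C σ)
    (hτ : IsModuleTransformation C τ) : IsModuleTransformation C (σ ≫ τ) := fun c d => by
  rw [NatTrans.comp_app, MonoidalLeftAction.actionHomRight_comp, Category.assoc, hτ,
    reassoc_of% (hσ c d), NatTrans.comp_app]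

instance : Category (LaxRex k C D E) where
  Hom F G := LaxRex.Hom F G
  id F := ⟨𝟙 F.functor, isModuleTransformation_id _⟩
  comp f g := ⟨f.nat ≫ g.nat, isModuleTransformation_comp f.isModule g.isModule⟩

@[ext]
theorem LaxRex.hom_ext {F G : LaxRex k C D E} {f g : F ⟶ G} (h : f.nat = g.nat) : f = g :=
  LaxRex.Hom.ext h

@[simp]
theorem LaxRex.id_nat (F : LaxRex k C D E) : LaxRex.Hom.nat (𝟙 F) = 𝟙 F.functor := rfl

@[simp]
theorem LaxRex.comp_nat {F G H : LaxRex k C D E} (f : F ⟶ G) (g : G ⟶ H) :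
    (f ≫ g).nat = f.nat ≫ g.nat := rfl

end LaxRex

section Biact

variable (k : Type w) [Semiring k]
variable (C : Type u₁) [Category.{v₁} C] [MonoidalCategory C]
variable {M : Type u₂} [Category.{v₂} M] [Preadditive M] [Linear k M] [MonoidalLeftAction C M]
variable (S T : Monad M) [LaxModuleMonad C S] [LaxModuleMonad C T]

open LaxLeftLinear

/-- A lax `C`-module `S`-`T`-biact functor: an `S`-`T`-bimodule object in the category of right
exact lax `C`-module endofunctors of `M`. Here `la : S ∘ F ⟶ F` is the left action and
`ra : F ∘ T ⟶ F` is the right action. -/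
structure Biact where
  carrier : LaxRex k C M M
  la : carrier.functor ⋙ S.toFunctor ⟶ carrier.functor
  ra : T.toFunctor ⋙ carrier.functor ⟶ carrier.functor
  la_isModule : IsModuleTransformation C la
  ra_isModule : IsModuleTransformation C ra
  la_unit (X : M) : S.η.app (carrier.functor.obj X) ≫ la.app X = 𝟙 (carrier.functor.obj X)
  la_assoc (X : M) :
    S.μ.app (carrier.functor.obj X) ≫ la.app X = S.map (la.app X) ≫ la.app X
  ra_unit (X : M) : carrier.functor.map (T.η.app X) ≫ ra.app X = 𝟙 (carrier.functor.obj X)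
  ra_assoc (X : M) :
    carrier.functor.map (T.μ.app X) ≫ ra.app X = ra.app (T.obj X) ≫ ra.app X
  la_ra (X : M) : S.map (ra.app X) ≫ la.app X = la.app (T.obj X) ≫ ra.app X

variable {k C S T}

/-- Morphisms of lax `C`-module biact functors: `C`-module transformations which commute with both
actions. -/
@[ext]
structure Biact.Hom (F G : Biact k C S T) where
  hom : F.carrier ⟶ G.carrier
  la_comm (X : M) : F.la.app X ≫ hom.nat.app X = S.map (hom.nat.app X) ≫ G.la.app X
  ra_comm (X : M) : F.ra.app X ≫ hom.nat.app X = hom.nat.app (T.obj X) ≫ G.ra.app X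

instance : Category (Biact k C S T) where
  Hom F G := Biact.Hom F G
  id F := ⟨𝟙 F.carrier, fun X => by simp, fun X => by simp⟩
  comp f g := ⟨f.hom ≫ g.hom,
    fun X => by
      simp only [LaxRex.comp_nat, NatTrans.comp_app, Functor.map_comp, Category.assoc]
      rw [reassoc_of% (f.la_comm X), g.la_comm],
    fun X => by
      simp only [LaxRex.comp_nat, NatTrans.comp_app, Category.assoc]
      rw [reassoc_of% (f.ra_comm X), g.ra_comm]⟩

@[ext]
theorem Biact.hom_ext {F G : Biact k C S T} {f g : F ⟶ G} (h : f.hom = g.hom) : f = g :=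
  Biact.Hom.ext h

@[simp]
theorem Biact.id_hom (F : Biact k C S T) : Biact.Hom.hom (𝟙 F) = 𝟙 F.carrier := rfl

@[simp]
theorem Biact.comp_hom {F G H : Biact k C S T} (f : F ⟶ G) (g : G ⟶ H) :
    (f ≫ g).hom = f.hom ≫ g.hom := rfl

/-! ### The functor `F ↦ F̄ ∘_T -` -/

/-- The functor `F̄ : M ⥤ EM(S)` which equips `F X` with the left action of `S`. -/
def Biact.bar (F : Biact k C S T) : M ⥤ S.Algebra where
  obj X :=
    { A := F.carrier.functor.obj X
      a := F.la.app X
      unit := F.la_unit X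
      assoc := F.la_assoc X }
  map f :=
    { f := F.carrier.functor.map f
      h := F.la.naturality f }
  map_id _ := Monad.Algebra.Hom.ext (F.carrier.functor.map_id _)
  map_comp _ _ := Monad.Algebra.Hom.ext (F.carrier.functor.map_comp _ _)

/-- The right action of `T` on `F`, as a morphism of `S`-modules. -/
def Biact.barRa (F : Biact k C S T) (X : M) : F.bar.obj (T.obj X) ⟶ F.bar.obj X where
  f := F.ra.app X
  h := F.la_ra X

theorem Biact.barRa_naturality (F : Biact k C S T) {X Y : M} (f : X ⟶ Y) :
    F.bar.map (T.map f) ≫ F.barRa Y = F.barRa X ≫ F.bar.map f :=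
  Monad.Algebra.Hom.ext (F.ra.naturality f)

/-- The natural transformation `F̄ ⟶ Ḡ` induced by a morphism of biact functors. -/
def Biact.barMap {F G : Biact k C S T} (f : F ⟶ G) : F.bar ⟶ G.bar where
  app X :=
    { f := f.hom.nat.app X
      h := (f.la_comm X).symm }
  naturality _ _ g := Monad.Algebra.Hom.ext (f.hom.nat.naturality g)

theorem Biact.barMap_barRa {F G : Biact k C S T} (f : F ⟶ G) (X : M) :
    F.barRa X ≫ (Biact.barMap f).app X = (Biact.barMap f).app (T.obj X) ≫ G.barRa X :=
  Monad.Algebra.Hom.ext (f.ra_comm X)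

variable [HasFiniteColimits M] [PreservesFiniteColimits S.toFunctor]

/-- The object `F̄ ∘_T X`: the coequalizer in `EM(S)` of `F ∇_X` and the right action
`F T X ⟶ F X`. -/
noncomputable def Biact.relObj (F : Biact k C S T) (X : T.Algebra) : S.Algebra :=
  coequalizer (F.bar.map X.a) (F.barRa X.A)

/-- The projection onto the coequalizer. -/
noncomputable def Biact.relProj (F : Biact k C S T) (X : T.Algebra) :
    F.bar.obj X.A ⟶ F.relObj X :=
  coequalizer.π _ _

theorem Biact.relProj_condition (F : Biact k C S T) (X : T.Algebra) :
    F.bar.map X.a ≫ F.relProj X = F.barRa X.A ≫ F.relProj X :=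
  coequalizer.condition _ _

theorem Biact.rel_hom_ext (F : Biact k C S T) {X : T.Algebra} {Y : S.Algebra}
    {f g : F.relObj X ⟶ Y} (h : F.relProj X ≫ f = F.relProj X ≫ g) : f = g :=
  coequalizer.hom_ext h

/-- The morphism between coequalizers induced by `F̄ g`, for `g` a morphism of `T`-modules. -/
noncomputable def Biact.relMap (F : Biact k C S T) {X Y : T.Algebra} (g : X ⟶ Y) :
    F.relObj X ⟶ F.relObj Y :=
  coequalizer.desc (F.bar.map g.f ≫ F.relProj Y) (by
    rw [← Functor.map_comp_assoc, ← g.h, Functor.map_comp_assoc, F.relProj_condition,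
      reassoc_of% (F.barRa_naturality g.f)])

theorem Biact.relProj_map (F : Biact k C S T) {X Y : T.Algebra} (g : X ⟶ Y) :
    F.relProj X ≫ F.relMap g = F.bar.map g.f ≫ F.relProj Y :=
  coequalizer.π_desc _ _

/-- The functor `F̄ ∘_T - : EM(T) ⥤ EM(S)`. -/
noncomputable def Biact.relTensor (F : Biact k C S T) : T.Algebra ⥤ S.Algebra where
  obj X := F.relObj X
  map g := F.relMap g
  map_id X := by
    apply F.rel_hom_ext
    rw [F.relProj_map, Monad.Algebra.id_f, F.bar.map_id, Category.id_comp, Category.comp_id]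
  map_comp f g := by
    apply F.rel_hom_ext
    rw [F.relProj_map, Monad.Algebra.comp_f, F.bar.map_comp, Category.assoc,
      reassoc_of% (F.relProj_map f), F.relProj_map g]

/-- The morphism between coequalizers induced by a morphism of biact functors. -/
noncomputable def Biact.relHom {F G : Biact k C S T} (f : F ⟶ G) (X : T.Algebra) :
    F.relObj X ⟶ G.relObj X :=
  coequalizer.desc ((Biact.barMap f).app X.A ≫ G.relProj X) (by
    rw [reassoc_of% ((Biact.barMap f).naturality X.a), G.relProj_condition,
      reassoc_of% (Biact.barMap_barRa f X.A)])

theorem Biact.relProj_hom {F G : Biact k C S T} (f : F ⟶ G) (X : T.Algebra) :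
    F.relProj X ≫ Biact.relHom f X = (Biact.barMap f).app X.A ≫ G.relProj X :=
  coequalizer.π_desc _ _

/-- The projection onto the coequalizer, on underlying objects. -/
noncomputable def Biact.relUnder (F : Biact k C S T) (X : T.Algebra) :
    F.carrier.functor.obj X.A ⟶ (F.relObj X).A :=
  (F.relProj X).f

theorem Biact.relUnder_condition (F : Biact k C S T) (X : T.Algebra) :
    F.carrier.functor.map X.a ≫ F.relUnder X = F.ra.app X.A ≫ F.relUnder X :=
  congrArg Monad.Algebra.Hom.f (F.relProj_condition X)

theorem Biact.relUnder_h (F : Biact k C S T) (X : T.Algebra) :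
    S.map (F.relUnder X) ≫ (F.relObj X).a = F.la.app X.A ≫ F.relUnder X :=
  (F.relProj X).h

theorem Biact.relUnder_map (F : Biact k C S T) {X Y : T.Algebra} (g : X ⟶ Y) :
    F.relUnder X ≫ (F.relMap g).f = F.carrier.functor.map g.f ≫ F.relUnder Y :=
  congrArg Monad.Algebra.Hom.f (F.relProj_map g)

theorem Biact.relUnder_hom {F G : Biact k C S T} (f : F ⟶ G) (X : T.Algebra) :
    F.relUnder X ≫ (Biact.relHom f X).f = f.hom.nat.app X.A ≫ G.relUnder X :=
  congrArg Monad.Algebra.Hom.f (Biact.relProj_hom f X)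

instance Biact.bar_additive (F : Biact k C S T) [S.toFunctor.Additive] : F.bar.Additive where
  map_add := Monad.Algebra.Hom.ext F.carrier.functor.map_add

instance Biact.bar_preserves (F : Biact k C S T) : PreservesFiniteColimits F.bar where
  preservesFiniteColimits J _ _ := by
    have : PreservesColimitsOfShape J (F.bar ⋙ S.forget) :=
      inferInstanceAs (PreservesColimitsOfShape J F.carrier.functor)
    have : ReflectsColimitsOfShape J S.forget := reflectsColimitsOfShape_of_reflectsIsomorphisms
    exact preservesColimitsOfShape_of_reflects_of_preserves F.bar S.forget

variable [S.toFunctor.Additive] [S.toFunctor.Linear k] [T.toFunctor.Additive]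
  [T.toFunctor.Linear k] [PreservesFiniteColimits T.toFunctor] [RightExactAction C M]

/-- The parallel pair of which `F̄ ∘_T X` is the coequalizer, as a functor of `X`. -/
def Biact.relPair (F : Biact k C S T) : T.Algebra ⥤ WalkingParallelPair ⥤ S.Algebra where
  obj X := parallelPair (F.bar.map X.a) (F.barRa X.A)
  map {X Y} g := parallelPairHom _ _ _ _ (F.bar.map (T.map g.f)) (F.bar.map g.f)
    (by rw [← Functor.map_comp, ← g.h, Functor.map_comp]) (F.barRa_naturality g.f).symm
  map_id X := by
    ext i : 2
    cases i
    · exact (congrArg F.bar.map (T.map_id X.A)).trans (F.bar.map_id _)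
    · exact F.bar.map_id _
  map_comp f g := by
    ext i : 2
    cases i
    · exact (congrArg F.bar.map (T.map_comp f.f g.f)).trans (F.bar.map_comp _ _)
    · exact F.bar.map_comp _ _

instance Biact.relPair_preserves (F : Biact k C S T) : PreservesFiniteColimits F.relPair where
  preservesFiniteColimits J _ _ := by
    apply preservesColimitsOfShape_of_evaluation
    intro i
    cases i
    · exact inferInstanceAs (PreservesColimitsOfShape J (T.forget ⋙ T.toFunctor ⋙ F.bar))
    · exact inferInstanceAs (PreservesColimitsOfShape J (T.forget ⋙ F.bar))

instance Biact.relTensor_preserves (F : Biact k C S T) : PreservesFiniteColimits F.relTensor where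
  preservesFiniteColimits J _ _ := by
    have e : F.relPair ⋙ colim ≅ F.relTensor := NatIso.ofComponents (fun X => Iso.refl _)
      (fun {X Y} g => by
        have h1 : colimit.ι (F.relPair.obj X) .one ≫ colim.map (F.relPair.map g) =
            (F.relPair.map g).app .one ≫ colimit.ι (F.relPair.obj Y) .one := colimit.ι_map _ _
        have h2 : colim.map (F.relPair.map g) = F.relMap g :=
          F.rel_hom_ext (h1.trans (F.relProj_map g).symm)
        exact (Category.comp_id _).trans (h2.trans (Category.id_comp _).symm))
    exact preservesColimitsOfShape_of_natIso e

instance Biact.relTensor_additive (F : Biact k C S T) : F.relTensor.Additive where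
  map_add {X Y f g} := by
    apply F.rel_hom_ext
    refine (F.relProj_map (f + g)).trans ?_
    change F.bar.map (f.f + g.f) ≫ F.relProj Y = F.relProj X ≫ (F.relMap f + F.relMap g)
    rw [Functor.map_add, Preadditive.add_comp, Preadditive.comp_add, F.relProj_map, F.relProj_map]

instance Biact.relTensor_linear (F : Biact k C S T) : F.relTensor.Linear k where
  map_smul {X Y} f r := by
    apply F.rel_hom_ext
    refine (F.relProj_map (r • f)).trans ?_
    have h : F.bar.map (r • f.f) = r • F.bar.map f.f :=
      Monad.Algebra.Hom.ext (F.carrier.functor.map_smul r f.f)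
    change F.bar.map (r • f.f) ≫ F.relProj Y = F.relProj X ≫ (r • F.relMap f)
    rw [h, Linear.smul_comp, Linear.comp_smul, F.relProj_map]

theorem Biact.relUnder_epi (F : Biact k C S T) (c : C) (X : T.Algebra) :
    Epi (c ⊴ₗ F.relUnder X) := by
  have := RightExactAction.right (C := C) (D := M) c
  have : Epi (F.relProj X) := inferInstanceAs (Epi (coequalizer.π _ _))
  exact inferInstanceAs (Epi ((S.forget ⋙ MonoidalLeftAction.actionLeft M c).map (F.relProj X)))

theorem Biact.map_relUnder_epi (F : Biact k C S T) (c : C) (X : T.Algebra) :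
    Epi (c ⊴ₗ S.map (F.relUnder X)) := by
  have := RightExactAction.right (C := C) (D := M) c
  have : Epi (F.relProj X) := inferInstanceAs (Epi (coequalizer.π _ _))
  exact inferInstanceAs (Epi ((S.forget ⋙ S.toFunctor ⋙
    MonoidalLeftAction.actionLeft M c).map (F.relProj X)))

theorem Biact.exists_relUnder_desc (F : Biact k C S T) (c : C) (X : T.Algebra) {Y : M}
    (f : c ⊙ₗ F.carrier.functor.obj X.A ⟶ Y)
    (hf : c ⊴ₗ F.carrier.functor.map X.a ≫ f = c ⊴ₗ F.ra.app X.A ≫ f) :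
    ∃ g : c ⊙ₗ (F.relObj X).A ⟶ Y, c ⊴ₗ F.relUnder X ≫ g = f := by
  have := RightExactAction.right (C := C) (D := M) c
  have hl := isColimitOfHasCoequalizerOfPreservesColimit
    (S.forget ⋙ MonoidalLeftAction.actionLeft M c) (F.bar.map X.a) (F.barRa X.A)
  obtain ⟨g, hg⟩ := Cofork.IsColimit.desc' hl f hf
  exact ⟨g, hg⟩

theorem Biact.exists_relLineator (F : Biact k C S T) (c : C) (X : T.Algebra) :
    ∃ g : c ⊙ₗ (F.relObj X).A ⟶ (F.relObj (linton c X)).A, IsMultilinear g ∧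
      c ⊴ₗ F.relUnder X ≫ g = μₗ F.carrier.functor c X.A ≫
        F.carrier.functor.map (lintonUniv c X) ≫ F.relUnder (linton c X) := by
  have hu := lintonUniv_isMultilinear c X
  unfold IsMultilinear at hu
  have hr := F.ra_isModule c X.A
  have hl := F.la_isModule c X.A
  rw [laxComp_μₗ] at hr hl
  have nr := F.ra.naturality (lintonUniv c X)
  have nl := F.la.naturality (lintonUniv c X)
  simp only [Functor.comp_map] at nr nl
  obtain ⟨g, hg⟩ := F.exists_relUnder_desc c X (μₗ F.carrier.functor c X.A ≫
    F.carrier.functor.map (lintonUniv c X) ≫ F.relUnder (linton c X)) (by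
      rw [reassoc_of% hr, μₗ_naturality_right_assoc, ← Functor.map_comp_assoc, hu,
        Functor.map_comp_assoc, Functor.map_comp_assoc, F.relUnder_condition, reassoc_of% nr])
  refine ⟨g, ?_, hg⟩
  have := F.map_relUnder_epi c X
  unfold IsMultilinear
  rw [← cancel_epi (c ⊴ₗ S.map (F.relUnder X)), ← MonoidalLeftAction.actionHomRight_comp_assoc,
    F.relUnder_h, MonoidalLeftAction.actionHomRight_comp_assoc, hg, reassoc_of% hl,
    μₗ_naturality_right_assoc, ← S.map_comp_assoc, hg, S.map_comp_assoc, S.map_comp_assoc,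
    F.relUnder_h, reassoc_of% nl]

/-- The lax module structure `c ▶ (F̄ ∘_T X) ⟶ F̄ ∘_T (c ▶ X)` on the functor `F̄ ∘_T -`, induced by
the lax module structure of `F`. -/
noncomputable def Biact.relLineator (F : Biact k C S T) (c : C) (X : T.Algebra) :
    linton c (F.relObj X) ⟶ F.relObj (linton c X) :=
  lintonDesc (F.exists_relLineator c X).choose (F.exists_relLineator c X).choose_spec.1

/-- The characterisation of the lax module structure on `F̄ ∘_T -`. -/
theorem Biact.relLineator_spec (F : Biact k C S T) (c : C) (X : T.Algebra) :
    c ⊴ₗ F.relUnder X ≫ lintonUniv c (F.relObj X) ≫ (F.relLineator c X).f =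
      μₗ F.carrier.functor c X.A ≫ F.carrier.functor.map (lintonUniv c X) ≫
        F.relUnder (linton c X) := by
  rw [Biact.relLineator, lintonUniv_desc]
  exact (F.exists_relLineator c X).choose_spec.2

theorem Biact.linton_rel_hom_ext (F : Biact k C S T) {c : C} {X : T.Algebra} {Y : S.Algebra}
    {f g : linton c (F.relObj X) ⟶ Y}
    (h : c ⊴ₗ F.relUnder X ≫ lintonUniv c (F.relObj X) ≫ f.f =
      c ⊴ₗ F.relUnder X ≫ lintonUniv c (F.relObj X) ≫ g.f) : f = g := by
  have := F.relUnder_epi c X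
  exact linton_hom_ext ((cancel_epi _).1 h)

noncomputable instance Biact.relTensorLax (F : Biact k C S T) :
    F.relTensor.LaxLeftLinear C where
  μₗ c X := F.relLineator c X
  μₗ_naturality_left {c c'} g X := by
    apply F.linton_rel_hom_ext
    change c ⊴ₗ F.relUnder X ≫ lintonUniv c (F.relObj X) ≫ (lintonMapLeft g (F.relObj X)).f ≫
        (F.relLineator c' X).f =
      c ⊴ₗ F.relUnder X ≫ lintonUniv c (F.relObj X) ≫ (F.relLineator c X).f ≫
        (F.relMap (lintonMapLeft g X)).f
    rw [reassoc_of% lintonUniv_mapLeft, reassoc_of% (F.relLineator_spec c X), F.relUnder_map,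
      MonoidalLeftAction.action_exchange_assoc, F.relLineator_spec,
      ← Functor.map_comp_assoc, lintonUniv_mapLeft, Functor.map_comp_assoc,
      μₗ_naturality_left_assoc]
  μₗ_naturality_right c X Y g := by
    apply F.linton_rel_hom_ext
    change c ⊴ₗ F.relUnder X ≫ lintonUniv c (F.relObj X) ≫ (lintonMapRight c (F.relMap g)).f ≫
        (F.relLineator c Y).f =
      c ⊴ₗ F.relUnder X ≫ lintonUniv c (F.relObj X) ≫ (F.relLineator c X).f ≫
        (F.relMap (lintonMapRight c g)).f
    rw [reassoc_of% lintonUniv_mapRight, reassoc_of% (F.relLineator_spec c X), F.relUnder_map,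
      ← MonoidalLeftAction.actionHomRight_comp_assoc, F.relUnder_map,
      MonoidalLeftAction.actionHomRight_comp_assoc, F.relLineator_spec,
      ← Functor.map_comp_assoc, lintonUniv_mapRight, Functor.map_comp_assoc,
      μₗ_naturality_right_assoc]
  μₗ_associativity c c' X := by
    apply F.linton_rel_hom_ext
    change (c ⊗ c') ⊴ₗ F.relUnder X ≫ lintonUniv (c ⊗ c') (F.relObj X) ≫
        (F.relLineator (c ⊗ c') X).f ≫ (F.relMap (lintonAssoc c c' X).hom).f =
      (c ⊗ c') ⊴ₗ F.relUnder X ≫ lintonUniv (c ⊗ c') (F.relObj X) ≫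
        (lintonAssoc c c' (F.relObj X)).hom.f ≫ (lintonMapRight c (F.relLineator c' X)).f ≫
          (F.relLineator c (linton c' X)).f
    rw [reassoc_of% (F.relLineator_spec (c ⊗ c') X), F.relUnder_map,
      ← Functor.map_comp_assoc, lintonUniv_assoc, reassoc_of% lintonUniv_assoc,
      reassoc_of% lintonUniv_mapRight, ← MonoidalLeftAction.actionHomRight_comp_assoc,
      MonoidalLeftAction.tensor_actionHomRight_assoc, Iso.inv_hom_id_assoc,
      ← MonoidalLeftAction.actionHomRight_comp_assoc, F.relLineator_spec,
      MonoidalLeftAction.actionHomRight_comp_assoc, MonoidalLeftAction.actionHomRight_comp_assoc,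
      F.relLineator_spec, μₗ_naturality_right_assoc, Functor.map_comp_assoc,
      Functor.map_comp_assoc, μₗ_associativity_assoc]
  μₗ_unitality X := by
    apply F.linton_rel_hom_ext
    change 𝟙_ C ⊴ₗ F.relUnder X ≫ lintonUniv (𝟙_ C) (F.relObj X) ≫
        (lintonUnit C (F.relObj X)).hom.f =
      𝟙_ C ⊴ₗ F.relUnder X ≫ lintonUniv (𝟙_ C) (F.relObj X) ≫ (F.relLineator (𝟙_ C) X).f ≫
        (F.relMap (lintonUnit C X).hom).f
    rw [lintonUniv_unit, reassoc_of% (F.relLineator_spec (𝟙_ C) X), F.relUnder_map,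
      ← Functor.map_comp_assoc, lintonUniv_unit, ← MonoidalLeftAction.actionUnitIso_hom_naturality,
      μₗ_unitality F.carrier.functor, Category.assoc]

/-- The right exact lax module functor `F̄ ∘_T -`. -/
noncomputable def Biact.relLaxRex (F : Biact k C S T) : LaxRex k C T.Algebra S.Algebra where
  functor := F.relTensor
  lax := inferInstance
  additive := inferInstance
  linear := inferInstance
  rightExact := inferInstance

variable (k C S T) in
/-- The functor `F ↦ F̄ ∘_T -` from biact functors to right exact lax module functors. -/
noncomputable def relTensorFunctor : Biact k C S T ⥤ LaxRex k C T.Algebra S.Algebra where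
  obj F := F.relLaxRex
  map {F G} f :=
    { nat :=
        { app X := Biact.relHom f X
          naturality X Y g := by
            apply F.rel_hom_ext
            change F.relProj X ≫ F.relMap g ≫ Biact.relHom f Y =
              F.relProj X ≫ Biact.relHom f X ≫ G.relMap g
            rw [reassoc_of% (F.relProj_map g), Biact.relProj_hom,
              reassoc_of% (Biact.relProj_hom f X), G.relProj_map,
              (Biact.barMap f).naturality_assoc] }
      isModule c X := by
        apply F.linton_rel_hom_ext
        change c ⊴ₗ F.relUnder X ≫ lintonUniv c (F.relObj X) ≫
            (lintonMapRight c (Biact.relHom f X)).f ≫ (G.relLineator c X).f =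
          c ⊴ₗ F.relUnder X ≫ lintonUniv c (F.relObj X) ≫ (F.relLineator c X).f ≫
            (Biact.relHom f (linton c X)).f
        have h := f.hom.isModule c X.A
        have hn := f.hom.nat.naturality (lintonUniv c X)
        rw [reassoc_of% lintonUniv_mapRight, reassoc_of% (F.relLineator_spec c X),
          Biact.relUnder_hom, ← MonoidalLeftAction.actionHomRight_comp_assoc, Biact.relUnder_hom,
          MonoidalLeftAction.actionHomRight_comp_assoc, G.relLineator_spec, reassoc_of% h,
          reassoc_of% hn] }
  map_id F := by
    apply LaxRex.hom_ext
    ext X : 2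
    apply F.rel_hom_ext
    change F.relProj X ≫ Biact.relHom (𝟙 F) X = F.relProj X ≫ 𝟙 _
    rw [Biact.relProj_hom, Category.comp_id]
    exact Category.id_comp _
  map_comp {F G H} f g := by
    apply LaxRex.hom_ext
    ext X : 2
    apply F.rel_hom_ext
    change F.relProj X ≫ Biact.relHom (f ≫ g) X = F.relProj X ≫ Biact.relHom f X ≫ Biact.relHom g X
    rw [Biact.relProj_hom, reassoc_of% (Biact.relProj_hom f X), Biact.relProj_hom]
    exact Category.assoc ((Biact.barMap f).app X.A) ((Biact.barMap g).app X.A) (H.relProj X)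

/-! ### The functor `Φ ↦ R ∘ Φ ∘ L` -/

/-- The right exact lax module functor `R ∘ Φ ∘ L`. -/
noncomputable def cewCarrier (Φ : LaxRex k C T.Algebra S.Algebra) : LaxRex k C M M where
  functor := T.free ⋙ Φ.functor ⋙ S.forget
  lax := inferInstance
  additive := inferInstance
  linear := inferInstance
  rightExact := by
    have : PreservesFiniteColimits T.free := ⟨fun J _ _ =>
      (T.adj.leftAdjoint_preservesColimits).preservesColimitsOfShape⟩
    have := comp_preservesFiniteColimits Φ.functor S.forget
    exact comp_preservesFiniteColimits T.free (Φ.functor ⋙ S.forget)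

/-- The morphism of `S`-modules `c ▶ Φ L X ⟶ Φ L (c ⊙ X)` which is the lax module structure of
`Φ ∘ L`. -/
noncomputable def cewLineator (Φ : LaxRex k C T.Algebra S.Algebra) (c : C) (X : M) :
    linton c (Φ.functor.obj (T.free.obj X)) ⟶ Φ.functor.obj (T.free.obj (c ⊙ₗ X)) :=
  μₗ Φ.functor c (T.free.obj X) ≫ Φ.functor.map (freeLineator c X)

theorem cewCarrier_μₗ (Φ : LaxRex k C T.Algebra S.Algebra) (c : C) (X : M) :
    μₗ (cewCarrier Φ).functor c X =
      lintonUniv c (Φ.functor.obj (T.free.obj X)) ≫ (cewLineator Φ c X).f :=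
  Category.assoc (lintonUniv c (Φ.functor.obj (T.free.obj X))) (μₗ Φ.functor c (T.free.obj X)).f
    (Φ.functor.map (freeLineator c X)).f

variable (T) in
/-- The counit `ε_{L X} : L R L X ⟶ L X`, that is, the multiplication of `T` as a morphism of
free `T`-modules. -/
def freeMul (X : M) : T.free.obj (T.obj X) ⟶ T.free.obj X :=
  freeHom (Y := T.free.obj X) (T.μ.app X) (T.assoc X)

theorem freeMul_eq_counit (X : M) : freeMul T X = T.adj.counit.app (T.free.obj X) := by
  apply Monad.Algebra.Hom.ext
  simp
  rfl

theorem counit_app_f (Y : S.Algebra) : (S.adj.counit.app Y).f = Y.a := by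
  simp
  rfl

theorem freeMul_naturality {X Y : M} (f : X ⟶ Y) :
    T.free.map (T.map f) ≫ freeMul T Y = freeMul T X ≫ T.free.map f :=
  Monad.Algebra.Hom.ext (T.μ.naturality f)

theorem freeMul_unit (X : M) : T.free.map (T.η.app X) ≫ freeMul T X = 𝟙 _ :=
  Monad.Algebra.Hom.ext (T.right_unit X)

theorem freeMul_assoc (X : M) :
    T.free.map (T.μ.app X) ≫ freeMul T X = freeMul T (T.obj X) ≫ freeMul T X :=
  Monad.Algebra.Hom.ext (T.assoc X)

theorem freeMul_lineator (c : C) (X : M) :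
    lintonMapRight c (freeMul T X) ≫ freeLineator c X =
      freeLineator c (T.obj X) ≫ T.free.map (μₗ T.toFunctor c X) ≫ freeMul T (c ⊙ₗ X) := by
  apply linton_hom_ext
  have h1 : lintonUniv c (T.free.obj (T.obj X)) ≫
      (lintonMapRight c (freeMul T X) ≫ freeLineator c X).f =
      c ⊴ₗ T.μ.app X ≫ μₗ T.toFunctor c X := by
    rw [Monad.Algebra.comp_f, reassoc_of% lintonUniv_mapRight, lintonUniv_freeLineator]
    rfl
  have h2 : lintonUniv c (T.free.obj (T.obj X)) ≫ (freeLineator c (T.obj X)).f ≫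
      (T.free.map (μₗ T.toFunctor c X) ≫ freeMul T (c ⊙ₗ X)).f =
      μₗ T.toFunctor c (T.obj X) ≫ T.map (μₗ T.toFunctor c X) ≫ T.μ.app (c ⊙ₗ X) :=
    (Category.assoc _ _ _).symm.trans
      (congrArg (fun f => f ≫ T.map (μₗ T.toFunctor c X) ≫ T.μ.app (c ⊙ₗ X))
        (lintonUniv_freeLineator c (T.obj X)))
  exact h1.trans ((monad_μ_lin T c X).trans h2.symm)

theorem cewLineator_freeMul (Φ : LaxRex k C T.Algebra S.Algebra) (c : C) (X : M) :
    lintonMapRight c (Φ.functor.map (freeMul T X)) ≫ cewLineator Φ c X =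
      cewLineator Φ c (T.obj X) ≫ Φ.functor.map (T.free.map (μₗ T.toFunctor c X)) ≫
        Φ.functor.map (freeMul T (c ⊙ₗ X)) := by
  have h := μₗ_naturality_right Φ.functor c (freeMul T X)
  unfold cewLineator
  rw [Category.assoc, ← Functor.map_comp, ← Functor.map_comp, ← freeMul_lineator, Functor.map_comp]
  exact (reassoc_of% h) _

theorem cewLineator_mapRight {Φ Ψ : LaxRex k C T.Algebra S.Algebra} (t : Φ ⟶ Ψ) (c : C) (X : M) :
    lintonMapRight c (t.nat.app (T.free.obj X)) ≫ cewLineator Ψ c X =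
      cewLineator Φ c X ≫ t.nat.app (T.free.obj (c ⊙ₗ X)) := by
  have h := t.isModule c (T.free.obj X)
  unfold cewLineator
  rw [Category.assoc, NatTrans.naturality]
  exact (reassoc_of% h) _

/-- The biact functor `(R ∘ Φ ∘ L, R ε Φ L, R Φ ε L)`. Note that `R ε` is the natural
transformation `S ∘ R ⟶ R` whose component at an `S`-module is its action. -/
noncomputable def cewObj (Φ : LaxRex k C T.Algebra S.Algebra) : Biact k C S T where
  carrier := cewCarrier Φ
  la :=
    { app X := (Φ.functor.obj (T.free.obj X)).a
      naturality X Y f := (Φ.functor.map (T.free.map f)).h }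
  ra :=
    { app X := (Φ.functor.map (freeMul T X)).f
      naturality X Y f := by
        have h : (Φ.functor.map (T.free.map (T.map f)) ≫ Φ.functor.map (freeMul T Y)).f =
            (Φ.functor.map (freeMul T X) ≫ Φ.functor.map (T.free.map f)).f := by
          rw [← Functor.map_comp, freeMul_naturality, Functor.map_comp]
        exact h }
  la_isModule c X := by
    have h := isMultilinear_comp (lintonUniv_isMultilinear c (Φ.functor.obj (T.free.obj X)))
      (cewLineator Φ c X)
    unfold IsMultilinear at h
    rw [laxComp_μₗ, cewCarrier_μₗ]
    exact h.trans (Category.assoc _ _ _).symm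
  ra_isModule c X := by
    have h := congrArg (fun f => lintonUniv c (Φ.functor.obj (T.free.obj (T.obj X))) ≫ f.f)
      (cewLineator_freeMul Φ c X)
    rw [laxComp_μₗ, cewCarrier_μₗ, cewCarrier_μₗ]
    have h' : c ⊴ₗ (Φ.functor.map (freeMul T X)).f ≫
        lintonUniv c (Φ.functor.obj (T.free.obj X)) ≫ (cewLineator Φ c X).f = _ :=
      ((reassoc_of% (lintonUniv_mapRight c (Φ.functor.map (freeMul T X)))) _).symm.trans h
    have h3 : lintonUniv c (Φ.functor.obj (T.free.obj (T.obj X))) ≫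
        (cewLineator Φ c (T.obj X)).f ≫
          (Φ.functor.map (T.free.map (μₗ T.toFunctor c X))).f ≫
            (Φ.functor.map (freeMul T (c ⊙ₗ X))).f =
        ((lintonUniv c (Φ.functor.obj (T.free.obj (T.obj X))) ≫
          (cewLineator Φ c (T.obj X)).f) ≫
            (Φ.functor.map (T.free.map (μₗ T.toFunctor c X))).f) ≫
              (Φ.functor.map (freeMul T (c ⊙ₗ X))).f := by
      simp only [Category.assoc]
    exact h'.trans h3
  la_unit X := (Φ.functor.obj (T.free.obj X)).unit
  la_assoc X := (Φ.functor.obj (T.free.obj X)).assoc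
  ra_unit X := by
    have h : (Φ.functor.map (T.free.map (T.η.app X)) ≫ Φ.functor.map (freeMul T X)).f =
        𝟙 (Φ.functor.obj (T.free.obj X)).A := by
      rw [← Functor.map_comp, freeMul_unit]
      exact congrArg Monad.Algebra.Hom.f (Φ.functor.map_id (T.free.obj X))
    exact h
  ra_assoc X := by
    have h : (Φ.functor.map (T.free.map (T.μ.app X)) ≫ Φ.functor.map (freeMul T X)).f =
        (Φ.functor.map (freeMul T (T.obj X)) ≫ Φ.functor.map (freeMul T X)).f := by
      rw [← Functor.map_comp, freeMul_assoc, Functor.map_comp]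
    exact h
  la_ra X := (Φ.functor.map (freeMul T X)).h

/-- The morphism of biact functors `R t L`. -/
noncomputable def cewMap {Φ Ψ : LaxRex k C T.Algebra S.Algebra} (t : Φ ⟶ Ψ) :
    cewObj Φ ⟶ cewObj Ψ where
  hom :=
    { nat :=
        { app X := (t.nat.app (T.free.obj X)).f
          naturality X Y f :=
            congrArg Monad.Algebra.Hom.f (t.nat.naturality (T.free.map f)) }
      isModule c X := by
        have h := congrArg (fun f => lintonUniv c (Φ.functor.obj (T.free.obj X)) ≫ f.f)
          (cewLineator_mapRight t c X)
        have h' : c ⊴ₗ (t.nat.app (T.free.obj X)).f ≫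
            lintonUniv c (Ψ.functor.obj (T.free.obj X)) ≫ (cewLineator Ψ c X).f = _ :=
          ((reassoc_of% (lintonUniv_mapRight c (t.nat.app (T.free.obj X)))) _).symm.trans h
        refine (congrArg (fun f => c ⊴ₗ (t.nat.app (T.free.obj X)).f ≫ f)
          (cewCarrier_μₗ Ψ c X)).trans (h'.trans ?_)
        refine Eq.trans ?_ (congrArg (fun f => f ≫ (t.nat.app (T.free.obj (c ⊙ₗ X))).f)
          (cewCarrier_μₗ Φ c X)).symm
        exact (Category.assoc _ _ _).symm }
  la_comm X := (t.nat.app (T.free.obj X)).h.symm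
  ra_comm X := congrArg Monad.Algebra.Hom.f (t.nat.naturality (freeMul T X))

variable (k C S T) in
/-- The functor `Φ ↦ R ∘ Φ ∘ L` from right exact lax `C`-module functors `EM(T) ⥤ EM(S)` to
`S`-`T`-biact functors. -/
noncomputable def cew : LaxRex k C T.Algebra S.Algebra ⥤ Biact k C S T where
  obj Φ := cewObj Φ
  map t := cewMap t
  map_id _ := rfl
  map_comp _ _ := rfl

end Biact

end LaxModule

namespace LaxModule

/-! ### Invertibility of module transformations -/

section LaxRexIso

variable {k : Type w} [Semiring k] {C : Type u₁} [Category.{v₁} C] [MonoidalCategory C]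
  {D : Type u₂} [Category.{v₂} D] [Preadditive D] [Linear k D] [MonoidalLeftAction C D]
  {E : Type u₃} [Category.{v₃} E] [Preadditive E] [Linear k E] [MonoidalLeftAction C E]

/-! This is the Eilenberg–Watts argument relative to a monad. Every `T`-module `X` is the
coequalizer of `T T X ⇉ T X` (the maps `T ∇` and `μ`), so a right exact functor `Φ` on `EM(T)` is
recovered from its values on free modules together with the maps `Φ ε L`. These values are the
functor `Φ L`, and the maps are a right `T`-action on it. Values in `EM(S)` amount to a left
`S`-action on `R Φ L`, and morphisms of `EM(S)` are those that respect it. The inverse construction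
performs the coequalizer.

Two comparison morphisms carry the equivalence. From `R (F̄ ∘_T -) L` to `F` there is the map
induced by the right action. It is invertible because the coequalizer defining `F̄ ∘_T L X` is split
by the unit of `T`, with no exactness needed (`Biact.relFree_isIso`). From `F̄ ∘_T -` to `Φ`, where
`F = R Φ L`, there is the map induced by `Φ` of the action of `T` on `X`. It is invertible because
`Φ` preserves the canonical presentation of `X` (`relCewApp_isIso`).

It remains to see that both respect the actions of `C`. Morphisms out of `c ▶ (F̄ ∘_T X)` are
detected on `c ⊙ F X`, since `c ⊙ -` is right exact and the Linton coequalizer has a universal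
property for multilinear maps. After this restriction the first compatibility says that the right
action of `F` is a `C`-module transformation (`Biact.relFreeUnder_lineator`). The second follows
from the counit `L R ⟶ Id` being one, which in turn is the multilinearity of the universal map `c ⊙
X ⟶ c ▶ X` (`freeLineator_algebraAction`). Inverses of the comparisons are then compatible
automatically, and nowhere do the lax structures have to be invertible. -/

theorem isModuleTransformation_inv {F G : D ⥤ E} [F.LaxLeftLinear C] [G.LaxLeftLinear C]
    {τ : F ⟶ G} [IsIso τ] (hτ : IsModuleTransformation C τ) :
    IsModuleTransformation C (inv τ) := fun c d => by
  have h : c ⊴ₗ (inv τ).app d ≫ c ⊴ₗ τ.app d = 𝟙 _ := by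
    rw [← MonoidalLeftAction.actionHomRight_comp, ← NatTrans.comp_app, IsIso.inv_hom_id]
    exact MonoidalLeftAction.actionHomRight_id c _
  -- Once composed with the component of `τ` at `c ⊙ₗ d`, both sides reduce to the structure
  -- morphism of `G`.
  rw [← cancel_mono (τ.app (c ⊙ₗ d)), Category.assoc, Category.assoc, ← hτ c d,
    ← NatTrans.comp_app, IsIso.inv_hom_id, NatTrans.id_app, Category.comp_id, reassoc_of% h]

/-- Compatibility with `C` passes to the inverse transformation, so invertibility can be checked
componentwise, without building a module structure on the inverse by hand. -/
theorem LaxRex.isIso_of_isIso_nat {F G : LaxRex k C D E} (f : F ⟶ G) [IsIso f.nat] : IsIso f :=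
  ⟨⟨inv f.nat, isModuleTransformation_inv f.isModule⟩,
    LaxRex.hom_ext (IsIso.hom_inv_id f.nat), LaxRex.hom_ext (IsIso.inv_hom_id f.nat)⟩

end LaxRexIso

/-! ### Invertibility of bimodule morphisms -/

section BiactIso

variable {k : Type w} [Semiring k] {C : Type u₁} [Category.{v₁} C] [MonoidalCategory C]
  {M : Type u₂} [Category.{v₂} M] [Preadditive M] [Linear k M] [MonoidalLeftAction C M]
  {S T : Monad M} [LaxModuleMonad C S] [LaxModuleMonad C T]

/-- Commuting with either action also passes to the inverse: cancel a component of `f` on the right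
and use its own compatibility. -/
theorem Biact.isIso_of_isIso_nat {F G : Biact k C S T} (f : F ⟶ G) [IsIso f.hom.nat] :
    IsIso f := by
  have hi (X : M) : f.hom.nat.app X ≫ (inv f.hom.nat).app X = 𝟙 _ := by
    rw [← NatTrans.comp_app, IsIso.hom_inv_id, NatTrans.id_app]
  have hi' (X : M) : (inv f.hom.nat).app X ≫ f.hom.nat.app X = 𝟙 _ := by
    rw [← NatTrans.comp_app, IsIso.inv_hom_id, NatTrans.id_app]
  refine ⟨⟨⟨inv f.hom.nat, isModuleTransformation_inv f.hom.isModule⟩, fun X => ?_, fun X => ?_⟩,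
    Biact.hom_ext (LaxRex.hom_ext (IsIso.hom_inv_id f.hom.nat)),
    Biact.hom_ext (LaxRex.hom_ext (IsIso.inv_hom_id f.hom.nat))⟩
  · rw [← cancel_mono (f.hom.nat.app X), Category.assoc, Category.assoc, f.la_comm, hi',
      ← S.map_comp_assoc, hi', S.map_id, Category.id_comp, Category.comp_id]
  · rw [← cancel_mono (f.hom.nat.app X), Category.assoc, Category.assoc, f.ra_comm, hi',
      reassoc_of% (hi' (T.obj X)), Category.comp_id]

end BiactIso

section Equivalence

open LaxLeftLinear

variable {k : Type w} [Semiring k] {C : Type u₁} [Category.{v₁} C] [MonoidalCategory C]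
  {M : Type u₂} [Category.{v₂} M] [Preadditive M] [Linear k M] [MonoidalLeftAction C M]
  {S T : Monad M} [LaxModuleMonad C S] [LaxModuleMonad C T]
  [HasFiniteColimits M] [PreservesFiniteColimits S.toFunctor]

/-! ### The value of `F̄ ∘_T -` on free modules -/

/-- The morphism `F̄ ∘_T L X ⟶ F̄ X` induced by the right action of `T`. -/
noncomputable def Biact.relFree (F : Biact k C S T) (X : M) :
    F.relObj (T.free.obj X) ⟶ F.bar.obj X :=
  coequalizer.desc (F.barRa X) (Monad.Algebra.Hom.ext (F.ra_assoc X))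

/-- The projection `F̄ T X ⟶ F̄ ∘_T L X`. -/
noncomputable def Biact.relProjFree (F : Biact k C S T) (X : M) :
    F.bar.obj (T.obj X) ⟶ F.relObj (T.free.obj X) :=
  F.relProj (T.free.obj X)

/-- The action on the free module `T X` is `μ`, so here the coequalized pair is `F μ` and the right
action at `T X`. -/
theorem Biact.relProjFree_condition (F : Biact k C S T) (X : M) :
    F.bar.map (T.μ.app X) ≫ F.relProjFree X = F.barRa (T.obj X) ≫ F.relProjFree X :=
  F.relProj_condition (T.free.obj X)

theorem Biact.relProjFree_relFree (F : Biact k C S T) (X : M) :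
    F.relProjFree X ≫ F.relFree X = F.barRa X :=
  coequalizer.π_desc _ _

theorem Biact.relFree_hom_ext (F : Biact k C S T) {X : M} {Y : S.Algebra}
    {f g : F.relObj (T.free.obj X) ⟶ Y} (h : F.relProjFree X ≫ f = F.relProjFree X ≫ g) : f = g :=
  F.rel_hom_ext h

theorem Biact.relProjFree_map (F : Biact k C S T) {X Y : M} (g : T.free.obj X ⟶ T.free.obj Y) :
    F.relProjFree X ≫ F.relMap g =
      F.bar.map (Y := T.obj Y) (unfreeHom g) ≫ F.relProjFree Y :=
  F.relProj_map g

/-- The morphism `F̄ ∘_T L X ⟶ F̄ X`, on underlying objects. -/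
noncomputable def Biact.relFreeUnder (F : Biact k C S T) (X : M) :
    (F.relObj (T.free.obj X)).A ⟶ F.carrier.functor.obj X :=
  (F.relFree X).f

theorem Biact.relUnder_relFreeUnder (F : Biact k C S T) (X : M) :
    F.relUnder (T.free.obj X) ≫ F.relFreeUnder X = F.ra.app X :=
  congrArg Monad.Algebra.Hom.f (F.relProjFree_relFree X)

/-- The fork `F T T X ⇉ F T X ⟶ F X` is a split coequalizer in `EM(S)`, with splittings `F̄ η` and
`F̄ T η`. These are `S`-linear because `F̄` takes values in `EM(S)`. Hence `F X` is already the
coequalizer, whatever the exactness of `F`. -/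
instance Biact.relFree_isIso (F : Biact k C S T) (X : M) : IsIso (F.relFree X) := by
  refine ⟨F.bar.map (T.η.app X) ≫ F.relProjFree X, ?_, ?_⟩
  · apply F.relFree_hom_ext
    have h : F.bar.map (T.map (T.η.app X)) ≫ F.bar.map (T.μ.app X) = 𝟙 _ := by
      rw [← F.bar.map_comp, T.right_unit, F.bar.map_id]
    have hn := F.barRa_naturality (T.η.app X)
    rw [reassoc_of% (F.relProjFree_relFree X), Category.comp_id]
    -- Naturality exchanges the right action followed by `F η` for `F T η` followed by the right
    -- action at `T X`. The coequalizer relation turns the latter action into `F μ`, which cancels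
    -- `F T η`.
    refine ((reassoc_of% hn) (F.relProjFree X)).symm.trans ?_
    exact (congrArg (F.bar.map (T.map (T.η.app X)) ≫ ·) (F.relProjFree_condition X).symm).trans
      ((reassoc_of% h) _)
  · refine (Category.assoc _ _ _).trans ?_
    rw [F.relProjFree_relFree]
    exact Monad.Algebra.Hom.ext (F.ra_unit X)

/-! ### From bimodules to functors and back -/

variable [S.toFunctor.Additive] [S.toFunctor.Linear k] [T.toFunctor.Additive]
  [T.toFunctor.Linear k] [PreservesFiniteColimits T.toFunctor] [RightExactAction C M]

/-- This is the module compatibility of the comparison with `F`, the right-hand side being built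
from the composite lax structure on `R (F̄ ∘_T -) L`. Since `c ⊙ -` preserves the epimorphism `F T X
⟶ F̄ ∘_T L X`, it may be tested on `c ⊙ F T X`, where it becomes the hypothesis that `F.ra` is a
`C`-module transformation. -/
theorem Biact.relFreeUnder_lineator (F : Biact k C S T) (c : C) (X : M) :
    c ⊴ₗ F.relFreeUnder X ≫ μₗ F.carrier.functor c X =
      lintonUniv c (F.relObj (T.free.obj X)) ≫ (F.relLineator c (T.free.obj X)).f ≫
        (F.relMap (freeLineator c X)).f ≫ F.relFreeUnder (c ⊙ₗ X) := by
  have := F.relUnder_epi c (T.free.obj X)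
  rw [← cancel_epi (c ⊴ₗ F.relUnder (T.free.obj X))]
  have hra := F.ra_isModule c X
  rw [laxComp_μₗ, Category.assoc] at hra
  refine Eq.trans ?_ (hra.trans ?_)
  · refine ((MonoidalLeftAction.actionHomRight_comp_assoc c _ _ _).symm).trans ?_
    rw [F.relUnder_relFreeUnder]
    rfl
  -- The structure morphism of `L` was defined by descending that of `T` along the universal map, so
  -- the composite gives back `T_a`. This is the factor `F T_a` in the lax structure of `F T`.
  · have h : F.carrier.functor.map (lintonUniv c (T.free.obj X)) ≫
        F.carrier.functor.map (freeLineator c X).f =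
          F.carrier.functor.map (μₗ T.toFunctor c X) := by
      rw [← Functor.map_comp, lintonUniv_freeLineator]
      rfl
    rw [reassoc_of% (F.relLineator_spec c (T.free.obj X)),
      reassoc_of% (F.relUnder_map (freeLineator c X)), F.relUnder_relFreeUnder]
    exact congrArg (μₗ F.carrier.functor c (T.obj X) ≫ ·)
      ((congrArg (· ≫ F.ra.app (c ⊙ₗ X)) h).symm.trans (Category.assoc _ _ _))

/-- The canonical morphism `R ∘ (F̄ ∘_T -) ∘ L ⟶ F` of biact functors. -/
noncomputable def cewRelHom (F : Biact k C S T) : cewObj F.relLaxRex ⟶ F where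
  hom :=
    { nat :=
        { app X := F.relFreeUnder X
          naturality X Y f := by
            have h : F.relMap (T.free.map f) ≫ F.relFree Y = F.relFree X ≫ F.bar.map f := by
              apply F.relFree_hom_ext
              rw [reassoc_of% (F.relProjFree_map (T.free.map f)), F.relProjFree_relFree,
                reassoc_of% (F.relProjFree_relFree X)]
              exact F.barRa_naturality f
            exact congrArg Monad.Algebra.Hom.f h }
      isModule c X := by
        refine (F.relFreeUnder_lineator c X).trans ?_
        refine Eq.trans ?_ (congrArg (· ≫ F.relFreeUnder (c ⊙ₗ X))
          (cewCarrier_μₗ F.relLaxRex c X)).symm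
        refine Eq.trans ?_ (Category.assoc _ _ _).symm
        exact congrArg (lintonUniv c (F.relObj (T.free.obj X)) ≫ ·) (Category.assoc _ _ _).symm }
  -- The left action is respected because the comparison was constructed inside `EM(S)`.
  la_comm X := (F.relFree X).h.symm
  ra_comm X := by
    have h : F.relMap (freeMul T X) ≫ F.relFree X = F.relFree (T.obj X) ≫ F.barRa X := by
      apply F.relFree_hom_ext
      rw [reassoc_of% (F.relProjFree_map (freeMul T X)), F.relProjFree_relFree,
        reassoc_of% (F.relProjFree_relFree (T.obj X))]
      -- On `F T T X` the two sides are `F μ` followed by the action and the action applied twice.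
      exact Monad.Algebra.Hom.ext (F.ra_assoc X)
    exact congrArg Monad.Algebra.Hom.f h

/-- Each component is the image under `S.forget` of the isomorphism `relFree`. -/
instance cewRelHom_isIso (F : Biact k C S T) : IsIso (cewRelHom F) := by
  have (X : M) : IsIso ((cewRelHom F).hom.nat.app X) :=
    inferInstanceAs (IsIso (S.forget.map (F.relFree X)))
  have : IsIso (cewRelHom F).hom.nat := NatIso.isIso_of_isIso_app _
  exact Biact.isIso_of_isIso_nat _

variable (k C S T) in
/-- The natural isomorphism `R ∘ (F̄ ∘_T -) ∘ L ≅ F`. -/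
noncomputable def relTensorCewIso : relTensorFunctor k C S T ⋙ cew k C S T ≅ 𝟭 _ :=
  NatIso.ofComponents
    (fun F => @asIso _ _ _ _ (cewRelHom F) (cewRelHom_isIso F)) (fun {F G} f => by
    apply Biact.hom_ext
    apply LaxRex.hom_ext
    ext X
    -- Naturality is proved in `EM(S)`; on the projection from `F̄ T X` it is the compatibility of
    -- `f` with the right actions.
    have h : Biact.relHom f (T.free.obj X) ≫ G.relFree X =
        F.relFree X ≫ (Biact.barMap f).app X := by
      have hp : F.relProjFree X ≫ Biact.relHom f (T.free.obj X) =
        (Biact.barMap f).app (T.obj X) ≫ G.relProjFree X := Biact.relProj_hom f (T.free.obj X)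
      apply F.relFree_hom_ext
      rw [reassoc_of% hp, reassoc_of% (F.relProjFree_relFree X), G.relProjFree_relFree]
      exact (Biact.barMap_barRa f X).symm
    exact congrArg Monad.Algebra.Hom.f h)

/-! ### Reconstruction of a right exact functor from its values on free modules -/

/-- The action of a `T`-module as a morphism of `T`-modules out of a free one. -/
def algebraAction (X : T.Algebra) : T.free.obj X.A ⟶ X :=
  freeHom X.a X.assoc.symm

theorem algebraAction_naturality {X Y : T.Algebra} (g : X ⟶ Y) :
    T.free.map g.f ≫ algebraAction Y = algebraAction X ≫ g :=
  Monad.Algebra.Hom.ext g.h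

theorem algebraAction_condition (X : T.Algebra) :
    T.free.map X.a ≫ algebraAction X = freeMul T X.A ≫ algebraAction X :=
  Monad.Algebra.Hom.ext X.assoc.symm

/-- The canonical presentation of a `T`-module by free ones is a coequalizer. -/
noncomputable def algebraActionIsColimit (X : T.Algebra) :
    IsColimit (Cofork.ofπ (algebraAction X) (algebraAction_condition X)) :=
  Monad.beckAlgebraCoequalizer X

/-- The first two factors form the lax structure of `L R`, so this expresses that the counit `L R ⟶
Id` is a `C`-module transformation. Restricted along the universal map, it reads exactly as the
`T`-linearity of `lintonUniv c X`. -/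
theorem freeLineator_algebraAction (c : C) (X : T.Algebra) :
    freeLineator c X.A ≫ T.free.map (lintonUniv c X) ≫ algebraAction (linton c X) =
      lintonMapRight c (algebraAction X) := by
  apply linton_hom_ext
  have h := congrArg (· ≫ (linton c X).a) (lintonUniv_freeLineator_map c X.A (lintonUniv c X))
  refine Eq.trans ?_ ((lintonUniv_isMultilinear c X).symm.trans
    (lintonUniv_mapRight c (algebraAction X)).symm)
  refine Eq.trans ?_ (h.trans (Category.assoc _ _ _))
  refine Eq.trans ?_ (Category.assoc _ _ _).symm
  exact congrArg (fun f => lintonUniv c (T.free.obj X.A) ≫ f.f) (Category.assoc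
    (freeLineator c X.A) (T.free.map (lintonUniv c X)) (algebraAction (linton c X))).symm

/-! ### From functors to bimodules and back -/

theorem map_algebraAction_condition (Φ : LaxRex k C T.Algebra S.Algebra) (X : T.Algebra) :
    Φ.functor.map (T.free.map X.a) ≫ Φ.functor.map (algebraAction X) =
      Φ.functor.map (freeMul T X.A) ≫ Φ.functor.map (algebraAction X) := by
  rw [← Functor.map_comp, algebraAction_condition, Functor.map_comp]

/-- The projection `Φ L X ⟶ F̄ ∘_T X`, for `F = R ∘ Φ ∘ L`. -/
noncomputable def cewProj (Φ : LaxRex k C T.Algebra S.Algebra) (X : T.Algebra) :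
    Φ.functor.obj (T.free.obj X.A) ⟶ (cewObj Φ).relObj X :=
  (cewObj Φ).relProj X

/-- For `F = R Φ L` the functor `F̄` is `Φ L` by definition, so the defining pair of `F̄ ∘_T X` is
the image under `Φ` of the canonical presentation of `X`. -/
theorem cewProj_condition (Φ : LaxRex k C T.Algebra S.Algebra) (X : T.Algebra) :
    Φ.functor.map (T.free.map X.a) ≫ cewProj Φ X = Φ.functor.map (freeMul T X.A) ≫ cewProj Φ X :=
  (cewObj Φ).relProj_condition X

theorem cewProj_map (Φ : LaxRex k C T.Algebra S.Algebra) {X Y : T.Algebra} (g : X ⟶ Y) :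
    cewProj Φ X ≫ (cewObj Φ).relMap g = Φ.functor.map (T.free.map g.f) ≫ cewProj Φ Y :=
  (cewObj Φ).relProj_map g

theorem cewProj_hom {Φ Ψ : LaxRex k C T.Algebra S.Algebra} (t : Φ ⟶ Ψ) (X : T.Algebra) :
    cewProj Φ X ≫ Biact.relHom (cewMap t) X = t.nat.app (T.free.obj X.A) ≫ cewProj Ψ X :=
  Biact.relProj_hom (cewMap t) X

theorem cewProj_hom_ext (Φ : LaxRex k C T.Algebra S.Algebra) {X : T.Algebra} {Y : S.Algebra}
    {f g : (cewObj Φ).relObj X ⟶ Y} (h : cewProj Φ X ≫ f = cewProj Φ X ≫ g) : f = g :=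
  (cewObj Φ).rel_hom_ext h

/-- The morphism `F̄ ∘_T X ⟶ Φ X`, for `F = R ∘ Φ ∘ L`, induced by the action of `T` on `X`. -/
noncomputable def relCewApp (Φ : LaxRex k C T.Algebra S.Algebra) (X : T.Algebra) :
    (cewObj Φ).relObj X ⟶ Φ.functor.obj X :=
  coequalizer.desc (f := (cewObj Φ).bar.map X.a) (g := (cewObj Φ).barRa X.A)
    (Φ.functor.map (algebraAction X)) (map_algebraAction_condition Φ X)

theorem cewProj_relCewApp (Φ : LaxRex k C T.Algebra S.Algebra) (X : T.Algebra) :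
    cewProj Φ X ≫ relCewApp Φ X = Φ.functor.map (algebraAction X) :=
  coequalizer.π_desc _ _

theorem relUnder_relCewApp (Φ : LaxRex k C T.Algebra S.Algebra) (X : T.Algebra) :
    (cewObj Φ).relUnder X ≫ (relCewApp Φ X).f = (Φ.functor.map (algebraAction X)).f :=
  congrArg Monad.Algebra.Hom.f (cewProj_relCewApp Φ X)

/-- Right exactness of `Φ` makes `Φ X` a coequalizer of the same pair whose coequalizer defines `F̄
∘_T X`. The inverse `s` is the map that the universal property of `Φ X` assigns to the projection.
-/
instance relCewApp_isIso (Φ : LaxRex k C T.Algebra S.Algebra) (X : T.Algebra) :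
    IsIso (relCewApp Φ X) := by
  have hl := isColimitCoforkMapOfIsColimit Φ.functor _ (algebraActionIsColimit X)
  obtain ⟨s, hs⟩ := Cofork.IsColimit.desc' hl (cewProj Φ X) (cewProj_condition Φ X)
  have hs' : Φ.functor.map (algebraAction X) ≫ s = cewProj Φ X := hs
  refine ⟨s, ?_, ?_⟩
  · apply cewProj_hom_ext
    rw [reassoc_of% (cewProj_relCewApp Φ X), hs', Category.comp_id]
  · apply Cofork.IsColimit.hom_ext hl
    change Φ.functor.map (algebraAction X) ≫ s ≫ relCewApp Φ X =
      Φ.functor.map (algebraAction X) ≫ 𝟙 _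
    rw [reassoc_of% hs', cewProj_relCewApp, Category.comp_id]

/-- Applying `Φ` to the module compatibility of the counit and using naturality of the structure of
`Φ` shows that `Φ ε` is a module transformation. -/
theorem cewLineator_algebraAction (Φ : LaxRex k C T.Algebra S.Algebra) (c : C) (X : T.Algebra) :
    cewLineator Φ c X.A ≫ Φ.functor.map (T.free.map (lintonUniv c X)) ≫
        Φ.functor.map (algebraAction (linton c X)) =
      lintonMapRight c (Φ.functor.map (algebraAction X)) ≫ μₗ Φ.functor c X := by
  unfold cewLineator
  rw [Category.assoc, ← Functor.map_comp, ← Functor.map_comp, freeLineator_algebraAction]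
  exact (μₗ_naturality_right Φ.functor c (algebraAction X)).symm

/-- The canonical morphism `F̄ ∘_T - ⟶ Φ` of lax module functors, for `F = R ∘ Φ ∘ L`. -/
noncomputable def relCewHom (Φ : LaxRex k C T.Algebra S.Algebra) :
    (cewObj Φ).relLaxRex ⟶ Φ where
  nat :=
    { app X := relCewApp Φ X
      naturality X Y g := by
        apply cewProj_hom_ext
        change cewProj Φ X ≫ (cewObj Φ).relMap g ≫ relCewApp Φ Y =
          cewProj Φ X ≫ relCewApp Φ X ≫ Φ.functor.map g
        rw [reassoc_of% (cewProj_map Φ g), cewProj_relCewApp,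
          reassoc_of% (cewProj_relCewApp Φ X), ← Functor.map_comp, ← Functor.map_comp,
          algebraAction_naturality] }
  isModule c X := by
    -- It suffices to compare on `c ⊙ R Φ L R X`. There the comparison becomes `Φ ε` by
    -- `relUnder_relCewApp`, so the two sides, computed in `h1` and `h2`, are those of the preceding
    -- lemma restricted along the universal map.
    apply (cewObj Φ).linton_rel_hom_ext
    have h := congrArg (fun f => lintonUniv c (Φ.functor.obj (T.free.obj X.A)) ≫ f.f)
      (cewLineator_algebraAction Φ c X)
    have h1 : c ⊴ₗ (cewObj Φ).relUnder X ≫ lintonUniv c ((cewObj Φ).relObj X) ≫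
        (lintonMapRight c (relCewApp Φ X)).f ≫ (μₗ Φ.functor c X).f =
        lintonUniv c (Φ.functor.obj (T.free.obj X.A)) ≫
          (lintonMapRight c (Φ.functor.map (algebraAction X))).f ≫ (μₗ Φ.functor c X).f := by
      rw [reassoc_of% lintonUniv_mapRight, reassoc_of% lintonUniv_mapRight]
      exact (MonoidalLeftAction.actionHomRight_comp_assoc c _ _ _).symm.trans
        (congrArg (fun f => c ⊴ₗ f ≫ _) (relUnder_relCewApp Φ X))
    have h2 : c ⊴ₗ (cewObj Φ).relUnder X ≫ lintonUniv c ((cewObj Φ).relObj X) ≫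
        ((cewObj Φ).relLineator c X).f ≫ (relCewApp Φ (linton c X)).f =
        lintonUniv c (Φ.functor.obj (T.free.obj X.A)) ≫ (cewLineator Φ c X.A).f ≫
          (Φ.functor.map (T.free.map (lintonUniv c X))).f ≫
            (Φ.functor.map (algebraAction (linton c X))).f := by
      rw [reassoc_of% ((cewObj Φ).relLineator_spec c X), relUnder_relCewApp]
      refine (congrArg (· ≫ _) (cewCarrier_μₗ Φ c X.A)).trans ?_
      exact Category.assoc _ _ _
    exact h1.trans (h.symm.trans h2.symm)

instance relCewHom_isIso (Φ : LaxRex k C T.Algebra S.Algebra) : IsIso (relCewHom Φ) := by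
  have (X : T.Algebra) : IsIso ((relCewHom Φ).nat.app X) := relCewApp_isIso Φ X
  have : IsIso (relCewHom Φ).nat := NatIso.isIso_of_isIso_app _
  exact LaxRex.isIso_of_isIso_nat _

variable (k C S T) in
/-- The natural isomorphism `F̄ ∘_T - ≅ Φ`, for `F = R ∘ Φ ∘ L`. -/
noncomputable def cewRelTensorIso : cew k C S T ⋙ relTensorFunctor k C S T ≅ 𝟭 _ :=
  NatIso.ofComponents (fun Φ => @asIso _ _ _ _ (relCewHom Φ) (relCewHom_isIso Φ)) (fun {Φ Ψ} t => by
    apply LaxRex.hom_ext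
    ext X : 2
    apply (cewObj Φ).rel_hom_ext
    change cewProj Φ X ≫ Biact.relHom (cewMap t) X ≫ relCewApp Ψ X =
      cewProj Φ X ≫ relCewApp Φ X ≫ t.nat.app X
    rw [reassoc_of% (cewProj_hom t X), cewProj_relCewApp, reassoc_of% (cewProj_relCewApp Φ X)]
    -- On the projection from `Φ L X`, naturality in `Φ` reduces to naturality of `t` at the action
    -- `L X ⟶ X`.
    exact (t.nat.naturality (algebraAction X)).symm)

/-! ### The equivalence -/

variable (k C S T) in
/-- The equivalence between right exact lax module functors `EM(T) ⥤ EM(S)` and biact functors. -/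
noncomputable def cewEquivalence : LaxRex k C T.Algebra S.Algebra ≌ Biact k C S T :=
  -- Enforcing the triangle identities modifies only the unit isomorphism. Both functors are kept as
  -- given, so the final statement about them holds by definition.
  CategoryTheory.Equivalence.mk (cew k C S T) (relTensorFunctor k C S T)
    (cewRelTensorIso k C S T).symm (relTensorCewIso k C S T)

end Equivalence

end LaxModule

theorem theorem6p10 (k : Type w) [Field k]
    (C : Type u₁) [Category.{v₁} C] [Abelian C] [Linear k C] [MonoidalCategory C]
    [MonoidalPreadditive C] [MonoidalLinear k C]
    (M : Type u₂) [Category.{v₂} M] [Abelian M] [Linear k M] [MonoidalLeftAction C M]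
    [LaxModule.BilinearAction k C M] [LaxModule.RightExactAction C M]
    (S T : CategoryTheory.Monad M) [LaxModule.LaxModuleMonad C S] [LaxModule.LaxModuleMonad C T]
    [PreservesFiniteColimits S.toFunctor] [PreservesFiniteColimits T.toFunctor]
    [S.toFunctor.Additive] [S.toFunctor.Linear k] [T.toFunctor.Additive] [T.toFunctor.Linear k] :
    ∃ e : LaxModule.LaxRex k C T.Algebra S.Algebra ≌ LaxModule.Biact k C S T,
      e.functor = LaxModule.cew k C S T ∧
      Nonempty (e.inverse ≅ LaxModule.relTensorFunctor k C S T) := by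
  exact ⟨LaxModule.cewEquivalence k C S T, rfl, ⟨Iso.refl _⟩⟩
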